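/- Let $d\ge 1$ and $\alpha>0$. Let $\Lambda\subset\mathbb Z^d$ be finite, $N=|\Lambda|$, with $\mathrm{dist}$ the Euclidean distance; each site carries a finite-level quantum system, $\mathcal H$ is the tensor product of the local Hilbert spaces and $\|\cdot\|$ is the operator norm on $\mathcal B(\mathcal H)$. Let $\mathcal L=\sum_{Z\subseteq\Lambda}\mathcal L_Z$ be a time-independent Liouvillian, where each $\mathcal L_Z$ is a Lindblad generator whose Hamiltonian $H_Z=H_Z^\dagger$ and jump operators $L_{Z,k}$ are supported on $Z$, with adjoint $\mathcal L_Z^\dagger O=i[H_Z,O]+\sum_k\big(L_{Z,k}^\dagger OL_{Z,k}-\tfrac12\{L_{Z,k}^\dagger L_{Z,k},O\}\big)$. Assume the long-range condition $$\sum_{Z\ni i,j}\|\mathcal L_Z^\dagger\|_\infty\le\frac1{\mathrm{dist}(i,j)^\alpha}\quad(i\ne j),\qquad \|\mathcal M\|_\infty=\sup_{O\neq0}\frac{\|\mathcal M O\|}{\|O\|}.$$ Let $A$ be an operator supported on a single site $X\in\Lambda$, let $r>0$, and let $\tilde{\mathcal L}=\sum_{Z\subseteq B_r(X)}\mathcal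 L_Z$ be the restriction of $\mathcal L$ to the ball $B_r(X)=\{i\in\Lambda:\mathrm{dist}(i,X)\le r\}$. Put $A(t)=e^{\mathcal L^\dagger t}A$ and $\tilde A(t)=e^{\tilde{\mathcal L}^\dagger t}A$. Then $$\|A(t)-\tilde A(t)\|\le K\,\|A\|\,\mathcal C$$ in each of the following cases. The constants $K,v,c>0$ depend only on $d,\alpha$ and on what is indicated; in particular they do not depend on $\Lambda$, the local dimensions, $\mathcal L$, $X$, $A$, $r$, $t$. 1. If $\alpha>d$: $\mathcal C=e^{vt}/r^{\alpha-d}$, for all $r>0$, $t\ge0$. 2. If $\alpha>3d$: $\mathcal C=t^{\alpha-d+1}/r^{\alpha-3d}$, for large $r$ and times bounded away from $0$: for every $t_0>0$ there is $r_0=r_0(t_0,d,\alpha)>0$ such that the bound holds, with $K$ independent of $t_0$, for all $t\ge t_0$ and $r\ge r_0$. 3. If $d=1$, $\alpha>3$ and $\mathcal L$ is two-body ($\mathcal L_Z=0$ for $|Z|>2$): $\mathcal C=t^2/r^{\alpha-3}$, for large $r$ outside a linear light cone: for every $t_0>0$ there is $r_0=r_0(t_0,\alpha)>0$ such that the bound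 holds, with $K,v$ independent of $t_0$, for all $t\ge t_0$ and $r\ge\max(r_0,vt)$. 4. If $\alpha<d$: let $\kappa>0$ and $r\ge\kappa N^{1/d}$, and put $J=cN^{1-\alpha/d}$, where $c$ does not depend on $\kappa$. Then $\mathcal C=(e^{Jt}-1)/J$ for all $t\ge t_0$, for every $t_0>0$, with $K=K(\kappa,t_0)$; and $\mathcal C=e^{Jt}-1$ for all $t\ge0$, with $K=K(\kappa)$. 5. If $\alpha=d$: let $\kappa>0$, $N\ge2$ and $r\ge\kappa N^{1/d}$, and put $J=c\log N$, where $c$ does not depend on $\kappa$. Then $\mathcal C=(e^{Jt}-1)/J$ for all $t\ge0$, with $K=K(\kappa)$. -/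

import Mathlib

/-! Long-range Liouvillians on finite subsets of the cubic lattice `ℤ^d`, in the Heisenberg picture.
Matrices carry the operator norm of the Euclidean (Hilbert space) norm throughout. -/

open scoped Matrix.Norms.L2Operator

namespace OpenLattice

/-- The Euclidean distance between two sites of the cubic lattice `ℤ^d`. -/
noncomputable def siteDist {d : ℕ} (i j : Fin d → ℤ) : ℝ :=
  Real.sqrt (∑ k, ((i k : ℝ) - (j k : ℝ)) ^ 2)

/-- Basis configurations: the site `x` of the finite lattice `Λ` carries a `q x`-level system, so that
the Hilbert space is `⨂_{x ∈ Λ} ℂ^{q x}`, with orthonormal basis indexed by `Config Λ q`. -/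
abbrev Config {d : ℕ} (Λ : Finset (Fin d → ℤ)) (q : Λ → ℕ) : Type :=
  (x : Λ) → Fin (q x)

/-- The algebra of all operators on the Hilbert space of the system. -/
abbrev Op {d : ℕ} (Λ : Finset (Fin d → ℤ)) (q : Λ → ℕ) : Type :=
  Matrix (Config Λ q) (Config Λ q) ℂ

open Classical in
/-- `O` is supported on the set of sites `Z`, that is `O = o ⊗ 1` with `o` an operator on
`⨂_{x ∈ Z} ℂ^{q x}` and `1` the identity on the other sites. -/
def SupportedOn {d : ℕ} {Λ : Finset (Fin d → ℤ)} {q : Λ → ℕ} (Z : Finset Λ) (O : Op Λ q) : Prop :=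
  ∃ o : Matrix ((x : Z) → Fin (q x)) ((x : Z) → Fin (q x)) ℂ,
    ∀ σ τ : Config Λ q, O σ τ =
      if ∀ x, x ∉ Z → σ x = τ x then o (fun x => σ x) (fun x => τ x) else 0

/-- A Liouvillian (in Lindblad form) supported on `Z`: a Hamiltonian and finitely many jump operators,
all of them supported on `Z`. -/
structure LocalLiouvillian {d : ℕ} (Λ : Finset (Fin d → ℤ)) (q : Λ → ℕ) (Z : Finset Λ) where
  /-- the Hamiltonian -/
  ham : Op Λ q
  ham_isHermitian : ham.IsHermitian
  ham_supportedOn : SupportedOn Z ham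
  /-- the number of jump operators -/
  numJumps : ℕ
  /-- the jump operators -/
  jump : Fin numJumps → Op Λ q
  jump_supportedOn : ∀ k, SupportedOn Z (jump k)

open Matrix in
/-- The adjoint Liouvillian
`O ↦ i[H, O] + ∑ₖ (Lₖ† O Lₖ - (Lₖ† Lₖ O + O Lₖ† Lₖ) / 2)` as a linear map. -/
noncomputable def LocalLiouvillian.adjointLin {d : ℕ} {Λ : Finset (Fin d → ℤ)} {q : Λ → ℕ}
    {Z : Finset Λ} (M : LocalLiouvillian Λ q Z) : Op Λ q →ₗ[ℂ] Op Λ q where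
  toFun O := Complex.I • (M.ham * O - O * M.ham) +
    ∑ k, ((M.jump k)ᴴ * O * M.jump k -
      (1 / 2 : ℂ) • ((M.jump k)ᴴ * M.jump k * O + O * ((M.jump k)ᴴ * M.jump k)))
  map_add' O P := by
    rw [add_add_add_comm, ← smul_add, ← Finset.sum_add_distrib]
    congr 1
    · congr 1
      noncomm_ring
    · refine Finset.sum_congr rfl fun k _ => ?_
      rw [sub_add_sub_comm, ← smul_add]
      congr 1
      · noncomm_ring
      · congr 1
        noncomm_ring
  map_smul' c O := by
    simp only [RingHom.id_apply, smul_add, Finset.smul_sum, smul_sub, Matrix.mul_smul,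
      Matrix.smul_mul, smul_comm c Complex.I, smul_comm c (1 / 2 : ℂ)]

/-- The adjoint Liouvillian as a bounded operator on the operator algebra with the operator norm; its
norm `‖M.adjoint‖` is the `∞ → ∞` superoperator norm. -/
noncomputable def LocalLiouvillian.adjoint {d : ℕ} {Λ : Finset (Fin d → ℤ)} {q : Λ → ℕ}
    {Z : Finset Λ} (M : LocalLiouvillian Λ q Z) : Op Λ q →L[ℂ] Op Λ q :=
  LinearMap.toContinuousLinearMap M.adjointLin

/-- A Liouvillian `ℒ = ∑_{Z ⊆ Λ} ℒ_Z`, given by its decomposition into local Liouvillians. -/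
abbrev Liouvillian {d : ℕ} (Λ : Finset (Fin d → ℤ)) (q : Λ → ℕ) : Type :=
  (Z : Finset Λ) → LocalLiouvillian Λ q Z

/-- The full adjoint Liouvillian `∑_Z ℒ_Z†`. -/
noncomputable def Liouvillian.adjoint {d : ℕ} {Λ : Finset (Fin d → ℤ)} {q : Λ → ℕ}
    (ℒ : Liouvillian Λ q) : Op Λ q →L[ℂ] Op Λ q :=
  ∑ Z, (ℒ Z).adjoint

/-- The adjoint of the restriction of `ℒ` to the set of sites `S`: only the terms with `Z ⊆ S` are
kept. -/
noncomputable def Liouvillian.adjointOn {d : ℕ} {Λ : Finset (Fin d → ℤ)} {q : Λ → ℕ}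
    (ℒ : Liouvillian Λ q) (S : Finset Λ) : Op Λ q →L[ℂ] Op Λ q :=
  ∑ Z ∈ S.powerset, (ℒ Z).adjoint

open Classical in
/-- The long-range condition: `∑_{Z ∋ i, j} ‖ℒ_Z†‖_{∞ → ∞} ≤ 1 / dist(i, j)^α` for all `i ≠ j`. -/
def Liouvillian.IsLongRange {d : ℕ} {Λ : Finset (Fin d → ℤ)} {q : Λ → ℕ}
    (ℒ : Liouvillian Λ q) (α : ℝ) : Prop :=
  ∀ i j : Λ, i ≠ j →
    ∑ Z with i ∈ Z ∧ j ∈ Z, ‖(ℒ Z).adjoint‖ ≤ 1 / siteDist i.1 j.1 ^ α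

/-- A two-body Liouvillian: only single-site and two-site terms act. -/
def Liouvillian.IsTwoBody {d : ℕ} {Λ : Finset (Fin d → ℤ)} {q : Λ → ℕ}
    (ℒ : Liouvillian Λ q) : Prop :=
  ∀ Z : Finset Λ, 2 < Z.card → (ℒ Z).adjoint = 0

open Classical in
/-- The ball of radius `r` around the site `X` in the lattice `Λ`. -/
noncomputable def ball {d : ℕ} {Λ : Finset (Fin d → ℤ)} (X : Λ) (r : ℝ) : Finset Λ :=
  {i : Λ | siteDist i.1 X.1 ≤ r}

/-- The evolution `e^{tG} A` of the operator `A` for the time `t` under the generator `G`. -/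
noncomputable def evolve {d : ℕ} {Λ : Finset (Fin d → ℤ)} {q : Λ → ℕ}
    (G : Op Λ q →L[ℂ] Op Λ q) (t : ℝ) (A : Op Λ q) : Op Λ q :=
  NormedSpace.exp ((t : ℂ) • G) A

/-- The error `‖A(t) - Ã(t)‖`, where `A(t)` evolves under the full adjoint Liouvillian and `Ã(t)` under
the adjoint of its restriction to the ball of radius `r` around `X`. -/
noncomputable def truncationError {d : ℕ} {Λ : Finset (Fin d → ℤ)} {q : Λ → ℕ}
    (ℒ : Liouvillian Λ q) (X : Λ) (r t : ℝ) (A : Op Λ q) : ℝ :=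
  ‖evolve ℒ.adjoint t A - evolve (ℒ.adjointOn (ball X r)) t A‖

end OpenLattice

open OpenLattice

/-! An Euler step of a Lindblad generator is completely positive and unital up to second order in
the step, so the Heisenberg evolution contracts the operator norm
(`IsDissipative.norm_semigroup_le`). By Duhamel's formula, two evolutions then differ by at most the
time integral of the difference of the generators applied to one of them (`norm_semigroup_sub_le`).

Locality is measured site by site through `variation`. A local term annihilates operators that act
trivially on its support, so its effect is bounded by its norm times the sum of the variations over
the support. Comparing the evolution with one in which a site is decoupled from all others yields a
closed system of integral inequalities for the variations, with matrix `2 * coupling`. The decay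
function `(1 + dist)^{-α}` reproduces itself under this matrix up to a factor proportional to its
row sum `Γ`, so a barrier growing exponentially at a rate proportional to `Γ` dominates the
variations. The outcome is `norm_semigroup_adjointOn_sub_le`, valid for every `α > 0`. Here `Γ` is
bounded for `α > d`, of order `N^{1-α/d}` for `α < d`, and of order `log N` for `α = d`; this
settles the three bounds with exponentials.

For `α > 3d` the time is cut into `⌈t⌉` slices of length at most 1, so that the exponential stays
bounded; the support grows by `r / ⌈t⌉` in each slice and the errors add up to a power law.

On the chain, the total decay across a gap of width `x` at the boundary of an interval is of order
`x^{-(α-2)}`, whatever the length of the interval. For `α > 3` this tail is summable. A sum of two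
heavy-tailed displacements is large essentially only if one of them is, so doubling the time
multiplies the tail by a factor that can be kept close to 2 (`SpreadBound.double`). The factor is
absorbed into a width growing by `ρ < 2` per doubling, so the accumulated offset stays linear in
time (`exists_spreadBound`). Inside the linear cone only the heavy tail reaches distance `r / 2`,
and a final sum over time slices gives the bound. -/

namespace OpenLattice

/-! ### Contraction semigroups and Duhamel's formula -/

section Semigroup

variable {E : Type*} [NormedAddCommGroup E] [NormedSpace ℂ E]

/-- The infinitesimal step `1 + εG` is a contraction up to second order in `ε`. -/
def IsDissipative (G : E → E) : Prop :=
  ∃ C : ℝ, ∀ ε : ℝ, 0 ≤ ε → ∀ x, ‖x + (ε : ℂ) • G x‖ ≤ (1 + C * ε ^ 2) * ‖x‖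

lemma isDissipative_zero : IsDissipative (fun _ : E => (0 : E)) :=
  ⟨0, fun ε _ x => by simp⟩

/-- A step with the sum is the average of two steps of doubled length with the summands. -/
lemma IsDissipative.add {G H : E → E} (hG : IsDissipative G) (hH : IsDissipative H) :
    IsDissipative fun x => G x + H x := by
  obtain ⟨C, hC⟩ := hG
  obtain ⟨D, hD⟩ := hH
  refine ⟨2 * C + 2 * D, fun ε hε x => ?_⟩
  have h1 := hC (2 * ε) (by positivity) x
  have h2 := hD (2 * ε) (by positivity) x
  have : x + (ε : ℂ) • (G x + H x) = (1 / 2 : ℂ) • (x + ((2 * ε : ℝ) : ℂ) • G x) +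
      (1 / 2 : ℂ) • (x + ((2 * ε : ℝ) : ℂ) • H x) := by
    simp only [Complex.ofReal_mul, Complex.ofReal_ofNat]
    module
  rw [this]
  refine (norm_add_le _ _).trans ?_
  rw [norm_smul, norm_smul]
  have : ‖(1 / 2 : ℂ)‖ = 1 / 2 := by norm_num
  rw [this]
  nlinarith [norm_nonneg x]

lemma IsDissipative.sum {ι : Type*} (s : Finset ι) {G : ι → E → E}
    (h : ∀ i ∈ s, IsDissipative (G i)) : IsDissipative fun x => ∑ i ∈ s, G i x := by
  classical
  induction s using Finset.induction_on with
  | empty => simpa using isDissipative_zero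
  | insert a s ha ih =>
    simp only [Finset.sum_insert ha]
    exact (h a (by simp)).add (ih fun i hi => h i (by simp [hi]))

/-- The one-parameter semigroup `e^{tG}`. -/
noncomputable def semigroup (G : E →L[ℂ] E) (t : ℝ) : E →L[ℂ] E :=
  NormedSpace.exp ((t : ℂ) • G)

@[simp] lemma semigroup_zero (G : E →L[ℂ] E) : semigroup G 0 = 1 := by
  simp [semigroup]

variable [CompleteSpace E]

lemma semigroup_add (G : E →L[ℂ] E) (s t : ℝ) :
    semigroup G (s + t) = semigroup G s * semigroup G t := by
  let _ := NormedAlgebra.restrictScalars ℚ ℂ (E →L[ℂ] E)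
  unfold semigroup
  rw [Complex.ofReal_add, add_smul, NormedSpace.exp_add_of_commute]
  exact ((Commute.refl G).smul_left _).smul_right _

lemma semigroup_add_apply (G : E →L[ℂ] E) (s t : ℝ) (x : E) :
    semigroup G (s + t) x = semigroup G s (semigroup G t x) := by
  rw [semigroup_add]; rfl

lemma semigroup_nat_mul (G : E →L[ℂ] E) (n : ℕ) (t : ℝ) :
    semigroup G (n * t) = semigroup G t ^ n := by
  induction n with
  | zero => simp
  | succ n ih => rw [Nat.cast_succ, add_mul, one_mul, semigroup_add, ih, pow_succ]

/-- For any `η > 0`, a sufficiently short step `ε` has norm at most `1 + ηε`, since both the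
dissipativity defect and the Taylor remainder are `o(ε)`. Compounding the steps gives `e^{ηt}`, and
`η` tends to 0. -/
lemma IsDissipative.norm_semigroup_le {G : E →L[ℂ] E} (hG : IsDissipative ⇑G) {t : ℝ}
    (ht : 0 ≤ t) : ‖semigroup G t‖ ≤ 1 := by
  obtain ⟨C, hC⟩ := hG
  have key : ∀ η : ℝ, 0 < η → ‖semigroup G t‖ ≤ Real.exp (η * t) := by
    intro η hη
    have hd := (hasDerivAt_exp_smul_const G (0 : ℂ)).isLittleO
    simp only [zero_smul, NormedSpace.exp_zero, one_mul, sub_zero] at hd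
    have h1 := hd.def (c := η / 2) (by positivity)
    have h2 : Filter.Tendsto (fun n : ℕ => t / ((n : ℝ) + 1)) Filter.atTop (nhds 0) := by
      have := tendsto_one_div_add_atTop_nhds_zero_nat (𝕜 := ℝ)
      simpa [div_eq_mul_inv] using this.const_mul t
    have h3 := ((Complex.continuous_ofReal.tendsto' 0 0 Complex.ofReal_zero).comp h2).eventually h1
    have h4 : ∀ᶠ n : ℕ in Filter.atTop, C * (t / ((n : ℝ) + 1)) < η / 2 := by
      have := h2.const_mul C
      rw [mul_zero] at this
      exact this.eventually (gt_mem_nhds (by positivity))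
    obtain ⟨n, hn, hn'⟩ := (h3.and h4).exists
    set ε := t / ((n : ℝ) + 1) with hε
    have hε0 : 0 ≤ ε := by positivity
    have hstep : ‖semigroup G ε‖ ≤ 1 + η * ε := by
      have e1 : ‖1 + (ε : ℂ) • G‖ ≤ 1 + η / 2 * ε := by
        refine ContinuousLinearMap.opNorm_le_bound _ (by positivity) fun x => ?_
        refine (hC ε hε0 x).trans ?_
        refine mul_le_mul_of_nonneg_right ?_ (norm_nonneg _)
        nlinarith [mul_le_mul_of_nonneg_right hn'.le hε0]
      have e2 : semigroup G ε = (semigroup G ε - 1 - (ε : ℂ) • G) + (1 + (ε : ℂ) • G) := by abel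
      rw [e2]
      refine (norm_add_le _ _).trans ?_
      simp only [Function.comp_apply, ← hε, Complex.norm_of_nonneg hε0] at hn
      change ‖semigroup G ε - 1 - (ε : ℂ) • G‖ ≤ _ at hn
      linarith
    have ht' : t = ((n + 1 : ℕ) : ℝ) * ε := by
      rw [hε]; push_cast; field_simp
    have hpow : ∀ m : ℕ, ‖semigroup G ε ^ m‖ ≤ (1 + η * ε) ^ m := by
      intro m
      induction m with
      | zero =>
        rw [pow_zero, pow_zero]
        exact ContinuousLinearMap.norm_id_le
      | succ m ih =>
        rw [pow_succ, pow_succ]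
        exact (norm_mul_le _ _).trans (mul_le_mul ih hstep (norm_nonneg _) (by positivity))
    rw [ht', semigroup_nat_mul]
    refine (hpow _).trans ?_
    calc (1 + η * ε) ^ (n + 1) ≤ Real.exp (η * ε) ^ (n + 1) := by
          gcongr
          linarith [Real.add_one_le_exp (η * ε)]
      _ = Real.exp (η * (((n + 1 : ℕ) : ℝ) * ε)) := by
          rw [← Real.exp_nat_mul]; ring_nf
  have hlim : Filter.Tendsto (fun η : ℝ => Real.exp (η * t)) (nhdsWithin 0 (Set.Ioi 0))
      (nhds 1) := by
    have : Continuous fun η : ℝ => Real.exp (η * t) := by fun_prop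
    simpa using (this.tendsto 0).mono_left nhdsWithin_le_nhds
  refine ge_of_tendsto hlim ?_
  filter_upwards [self_mem_nhdsWithin] with η hη using key η hη

lemma IsDissipative.norm_semigroup_apply_le {G : E →L[ℂ] E} (hG : IsDissipative ⇑G) {t : ℝ}
    (ht : 0 ≤ t) (x : E) : ‖semigroup G t x‖ ≤ ‖x‖ := by
  simpa using (semigroup G t).le_of_opNorm_le (hG.norm_semigroup_le ht) x

lemma semigroup_mem_of_invariant {G : E →L[ℂ] E} {V : Submodule ℂ E} (hV : IsClosed (V : Set E))
    (hG : ∀ x ∈ V, G x ∈ V) (t : ℝ) {x : E} (hx : x ∈ V) : semigroup G t x ∈ V := by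
  have hpow : ∀ n : ℕ, (((t : ℂ) • G) ^ n) x ∈ V := by
    intro n
    induction n with
    | zero => simpa using hx
    | succ n ih =>
      rw [pow_succ']
      exact V.smul_mem _ (hG _ ih)
  have hs := (NormedSpace.exp_series_hasSum_exp' (𝕂 := ℂ) ((t : ℂ) • G)).mapL
    (ContinuousLinearMap.apply ℂ E x)
  refine hV.mem_of_tendsto hs (Filter.Eventually.of_forall fun s => ?_)
  refine V.sum_mem fun n _ => ?_
  simpa using V.smul_mem _ (hpow n)

/-- Two semigroups compared by Duhamel's formula. -/
lemma norm_semigroup_sub_le {G H : E →L[ℂ] E} (hG : IsDissipative ⇑G) {x : E} {B B' : ℝ → ℝ}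
    (hB : ∀ s, HasDerivAt B (B' s) s) {t : ℝ} (ht : 0 ≤ t)
    (h : ∀ s, 0 ≤ s → s ≤ t → ‖(G - H) (semigroup H s x)‖ ≤ B' s) :
    ‖semigroup G t x - semigroup H t x‖ ≤ B t - B 0 := by
  -- The interpolation runs `H` up to time `s` and `G` afterwards. Only `G` acts on the defect, so
  -- only `G` has to be dissipative.
  set f : ℝ → E := fun s => semigroup G t x - semigroup G (t - s) (semigroup H s x) with hf
  have hder : ∀ s, HasDerivAt f (semigroup G (t - s) ((G - H) (semigroup H s x))) s := by
    intro s
    have h1 : HasDerivAt (fun z : ℂ => NormedSpace.exp (((t : ℂ) - z) • G))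
        (-(semigroup G (t - s) * G)) (s : ℂ) := by
      have := (hasDerivAt_exp_smul_const G ((t : ℂ) - s)).scomp (s : ℂ)
        ((hasDerivAt_id (s : ℂ)).const_sub (t : ℂ))
      simpa [semigroup, Function.comp_def] using this
    have h2 : HasDerivAt (fun z : ℂ => NormedSpace.exp (z • H) x)
        (H (semigroup H s x)) (s : ℂ) := by
      have := (hasDerivAt_exp_smul_const' H (s : ℂ)).clm_apply (hasDerivAt_const (s : ℂ) x)
      simpa [semigroup] using this
    have h3 := ((h1.clm_apply h2).const_sub (semigroup G t x)).scomp_of_eq s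
      (Complex.ofRealCLM.hasDerivAt (x := s)) rfl
    convert h3 using 1
    · ext u
      simp [hf, semigroup]
    · simp [semigroup]
      abel
  have := image_norm_le_of_norm_deriv_right_le_deriv_boundary (f := f) (a := 0) (b := t)
    (B := fun s => B s - B 0) (B' := B')
    (fun s _ => (hder s).continuousAt.continuousWithinAt) (fun s _ => (hder s).hasDerivWithinAt)
    (by simp [hf]) (fun s => (hB s).sub_const _)
    (fun s hs => (hG.norm_semigroup_apply_le (by linarith [hs.2]) _).trans (h s hs.1 hs.2.le))
    (Set.right_mem_Icc.2 ht)
  simpa [hf] using this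

end Semigroup

/-! ### Completely positive maps and Lindblad steps -/

section Kraus

open Matrix

variable {n : Type*} [Fintype n] [DecidableEq n]

/-- With `y` the image of `x`, one has `‖y‖² = ∑ ⟨V k y, O (V k x)⟩`; Cauchy–Schwarz over `k` and `∑
‖V k x‖² ≤ m ‖x‖²` finish. -/
lemma norm_kraus_le {ι : Type*} (s : Finset ι) (V : ι → Matrix n n ℂ) (O : Matrix n n ℂ) :
    ‖∑ k ∈ s, (V k)ᴴ * O * V k‖ ≤ ‖O‖ * ‖∑ k ∈ s, (V k)ᴴ * V k‖ := by
  set T := toEuclideanCLM (n := n) (𝕜 := ℂ) with hT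
  set W : ι → EuclideanSpace ℂ n →L[ℂ] EuclideanSpace ℂ n := fun k => T (V k) with hW
  have hadj : ∀ k, T (V k)ᴴ = ContinuousLinearMap.adjoint (W k) := fun k => map_star T (V k)
  set m := ‖∑ k ∈ s, (V k)ᴴ * V k‖ with hm
  have hsq : ∀ x, ∑ k ∈ s, ‖W k x‖ ^ 2 ≤ m * ‖x‖ ^ 2 := by
    intro x
    have h1 : ∑ k ∈ s, ‖W k x‖ ^ 2 =
        RCLike.re (inner ℂ x (T (∑ k ∈ s, (V k)ᴴ * V k) x)) := by
      simp only [map_sum, map_mul, hadj, _root_.sum_apply, inner_sum,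
        mul_apply_eq_comp, ContinuousLinearMap.adjoint_inner_right]
      exact Finset.sum_congr rfl fun k _ => (norm_sq_eq_re_inner (𝕜 := ℂ) _)
    rw [h1]
    refine (RCLike.re_le_norm _).trans ((norm_inner_le_norm _ _).trans ?_)
    have h2 : ‖T (∑ k ∈ s, (V k)ᴴ * V k) x‖ ≤ m * ‖x‖ :=
      ContinuousLinearMap.le_opNorm _ _
    nlinarith [norm_nonneg x]
  have hm0 : 0 ≤ m := norm_nonneg _
  rw [cstar_norm_def]
  refine ContinuousLinearMap.opNorm_le_bound _ (by positivity) fun x => ?_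
  set y := T (∑ k ∈ s, (V k)ᴴ * O * V k) x with hy
  have h3 : ‖y‖ ^ 2 ≤ ‖O‖ * ∑ k ∈ s, ‖W k y‖ * ‖W k x‖ := by
    have h1 : ‖y‖ ^ 2 = ∑ k ∈ s, RCLike.re (inner ℂ (W k y) (T O (W k x))) := by
      rw [norm_sq_eq_re_inner (𝕜 := ℂ)]
      nth_rewrite 2 [hy]
      simp only [map_sum, map_mul, hadj, _root_.sum_apply, inner_sum,
        mul_apply_eq_comp, ContinuousLinearMap.adjoint_inner_right]
      rfl
    rw [h1, Finset.mul_sum]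
    refine Finset.sum_le_sum fun k _ => ?_
    refine (RCLike.re_le_norm _).trans ((norm_inner_le_norm _ _).trans ?_)
    have h2 : ‖T O (W k x)‖ ≤ ‖O‖ * ‖W k x‖ := ContinuousLinearMap.le_opNorm _ _
    nlinarith [norm_nonneg (W k y)]
  have h4 : ∑ k ∈ s, ‖W k y‖ * ‖W k x‖ ≤ m * ‖y‖ * ‖x‖ := by
    refine abs_le_of_sq_le_sq' ?_ (by positivity) |>.2
    refine (Finset.sum_mul_sq_le_sq_mul_sq s _ _).trans ?_
    refine (mul_le_mul (hsq y) (hsq x) (Finset.sum_nonneg fun _ _ => sq_nonneg _)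
      (by positivity)).trans (le_of_eq (by ring))
  rcases (norm_nonneg y).eq_or_lt with h0 | h0
  · rw [← h0]; positivity
  · have : ‖y‖ * ‖y‖ ≤ ‖y‖ * (‖O‖ * m * ‖x‖) := by
      nlinarith [mul_le_mul_of_nonneg_left h4 (norm_nonneg O)]
    exact le_of_mul_le_mul_left this h0

lemma norm_conj_mul_le (V O : Matrix n n ℂ) : ‖Vᴴ * O * V‖ ≤ ‖O‖ * ‖Vᴴ * V‖ := by
  simpa using norm_kraus_le (Finset.univ : Finset Unit) (fun _ => V) O

lemma norm_conj_add_conj_le (V W O : Matrix n n ℂ) :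
    ‖Vᴴ * O * V + Wᴴ * O * W‖ ≤ ‖O‖ * ‖Vᴴ * V + Wᴴ * W‖ := by
  simpa using norm_kraus_le (Finset.univ : Finset Bool) (fun b => if b then V else W) O

lemma norm_one_add_smul_le {ε : ℝ} (M : Matrix n n ℂ) :
    ‖(1 : Matrix n n ℂ) + ((ε : ℂ) ^ 2) • M‖ ≤ 1 + ‖M‖ * ε ^ 2 := by
  refine (norm_add_le _ _).trans (add_le_add ?_ ?_)
  · rcases isEmpty_or_nonempty n with h | h
    · have : (1 : Matrix n n ℂ) = 0 := Subsingleton.elim _ _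
      simp [this]
    · exact norm_one.le
  · rw [norm_smul, norm_pow, Complex.norm_real, Real.norm_eq_abs, sq_abs, mul_comm]

/-- Conjugation by `1 - iεH`, which is unitary to first order, reproduces the step up to `ε² H O H`.
-/
lemma norm_commutator_step_le {H : Matrix n n ℂ} (hH : H.IsHermitian) (ε : ℝ)
    (O : Matrix n n ℂ) :
    ‖O + (ε : ℂ) • (Complex.I • (H * O - O * H))‖ ≤ (1 + 2 * ‖H * H‖ * ε ^ 2) * ‖O‖ := by
  set V : Matrix n n ℂ := 1 - ((ε : ℂ) * Complex.I) • H with hV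
  have hVs : Vᴴ = 1 + ((ε : ℂ) * Complex.I) • H := by
    rw [hV, conjTranspose_sub, conjTranspose_smul, hH.eq, conjTranspose_one]
    simp
  have e1 : Vᴴ * V = 1 + ((ε : ℂ) ^ 2) • (H * H) := by
    rw [hVs, hV]
    simp only [add_mul, mul_sub, one_mul, mul_one, smul_mul_assoc, mul_smul_comm, smul_add,
      smul_smul]
    have : (ε : ℂ) * Complex.I * ((ε : ℂ) * Complex.I) = - (ε : ℂ) ^ 2 := by
      linear_combination (ε : ℂ) ^ 2 * Complex.I_mul_I
    rw [this]; module
  have e2 : O + (ε : ℂ) • (Complex.I • (H * O - O * H)) =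
      Vᴴ * O * V - ((ε : ℂ) ^ 2) • (Hᴴ * O * H) := by
    rw [hVs, hV, hH.eq]
    simp only [add_mul, mul_sub, one_mul, mul_one, smul_mul_assoc, mul_smul_comm, smul_smul,
      smul_sub, smul_add, mul_assoc]
    have : (ε : ℂ) * (Complex.I * ((ε : ℂ) * Complex.I)) = - (ε : ℂ) ^ 2 := by
      linear_combination (ε : ℂ) ^ 2 * Complex.I_mul_I
    rw [this]; module
  rw [e2]
  refine (norm_sub_le _ _).trans ?_
  have h1 := norm_conj_mul_le V O
  rw [e1] at h1
  have h2 := norm_one_add_smul_le (ε := ε) (H * H)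
  have h3 := norm_conj_mul_le H O
  rw [norm_smul, norm_pow, Complex.norm_real, Real.norm_eq_abs, sq_abs]
  rw [hH.eq] at h3 ⊢
  nlinarith [mul_le_mul_of_nonneg_left h2 (norm_nonneg O),
    mul_le_mul_of_nonneg_left h3 (sq_nonneg ε)]

/-- The Kraus operators `1 - (ε/2) M†M` and `√ε M` reproduce the step to first order, and the linear
terms cancel in the sum of `V†V` and `W†W`. -/
lemma norm_jump_step_le (M : Matrix n n ℂ) {ε : ℝ} (hε : 0 ≤ ε) (O : Matrix n n ℂ) :
    ‖O + (ε : ℂ) • (Mᴴ * O * M - (1 / 2 : ℂ) • (Mᴴ * M * O + O * (Mᴴ * M)))‖ ≤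
      (1 + (‖(1 / 4 : ℂ) • (Mᴴ * M * (Mᴴ * M))‖ + ‖Mᴴ * M * (Mᴴ * M)‖) * ε ^ 2) * ‖O‖ := by
  set P := Mᴴ * M with hP
  have hPs : Pᴴ = P := by rw [hP, conjTranspose_mul, conjTranspose_conjTranspose]
  set V : Matrix n n ℂ := 1 - ((ε : ℂ) / 2) • P with hV
  have hVs : Vᴴ = V := by
    rw [hV, conjTranspose_sub, conjTranspose_smul, hPs, conjTranspose_one]
    simp
  set W : Matrix n n ℂ := ((Real.sqrt ε : ℝ) : ℂ) • M with hW
  have hsq : ((Real.sqrt ε : ℝ) : ℂ) * ((Real.sqrt ε : ℝ) : ℂ) = ε := by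
    rw [← Complex.ofReal_mul, Real.mul_self_sqrt hε]
  have hWO : ∀ O, Wᴴ * O * W = (ε : ℂ) • (Mᴴ * O * M) := by
    intro O
    rw [hW, conjTranspose_smul]
    simp only [smul_mul_assoc, mul_smul_comm, smul_smul]
    simp [hsq]
  have e1 : Vᴴ * V + Wᴴ * W = 1 + ((ε : ℂ) ^ 2) • ((1 / 4 : ℂ) • (P * P)) := by
    have := hWO 1
    rw [mul_one, mul_one, ← hP] at this
    rw [this, hVs, hV]
    simp only [sub_mul, mul_sub, one_mul, mul_one, smul_mul_assoc, mul_smul_comm, smul_smul]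
    module
  have e2 : O + (ε : ℂ) • (Mᴴ * O * M - (1 / 2 : ℂ) • (P * O + O * P)) =
      (Vᴴ * O * V + Wᴴ * O * W) - ((ε : ℂ) ^ 2 / 4) • (Pᴴ * O * P) := by
    rw [hWO, hVs, hV, hPs]
    simp only [sub_mul, mul_sub, one_mul, mul_one, smul_mul_assoc, mul_smul_comm, smul_smul,
      smul_sub]
    module
  rw [e2]
  refine (norm_sub_le _ _).trans ?_
  have h1 := norm_conj_add_conj_le V W O
  rw [e1] at h1
  have h2 := norm_one_add_smul_le (ε := ε) ((1 / 4 : ℂ) • (P * P))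
  have h3 := norm_conj_mul_le P O
  rw [norm_smul]
  have h4 : ‖(ε : ℂ) ^ 2 / 4‖ = ε ^ 2 / 4 := by
    rw [norm_div, norm_pow, Complex.norm_real, Real.norm_eq_abs, sq_abs]; norm_num
  rw [h4]
  rw [hPs] at h3 ⊢
  nlinarith [mul_le_mul_of_nonneg_left h2 (norm_nonneg O),
    mul_le_mul_of_nonneg_left h3 (sq_nonneg ε), mul_nonneg (sq_nonneg ε) (norm_nonneg (P * O * P))]

end Kraus

/-! ### Locality of operators and variations at a site -/

section Observables

open Matrix

variable {d : ℕ} {Λ : Finset (Fin d → ℤ)} {q : Λ → ℕ}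

instance : CompleteSpace (Op Λ q) := FiniteDimensional.complete ℂ _

/-- The matrix unit `|a⟩⟨b|` at the site `x`, tensored with the identity on the other sites. -/
def siteUnit (x : Λ) (a b : Fin (q x)) : Op Λ q :=
  Matrix.of fun σ τ => if σ x = a ∧ τ = Function.update σ x b then 1 else 0

lemma siteUnit_mul_apply (x : Λ) (a b : Fin (q x)) (O : Op Λ q) (σ τ : Config Λ q) :
    (siteUnit x a b * O) σ τ = if σ x = a then O (Function.update σ x b) τ else 0 := by
  rw [mul_apply, Finset.sum_eq_single (Function.update σ x b)]
  · by_cases h : σ x = a <;> simp [siteUnit, h]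
  · intro υ _ h
    simp [siteUnit, h]
  · simp

lemma mul_siteUnit_apply (x : Λ) (a b : Fin (q x)) (O : Op Λ q) (σ τ : Config Λ q) :
    (O * siteUnit x a b) σ τ = if τ x = b then O σ (Function.update τ x a) else 0 := by
  have key : ∀ υ : Config Λ q, (υ x = a ∧ τ = Function.update υ x b) ↔
      (τ x = b ∧ υ = Function.update τ x a) := by
    intro υ
    constructor
    · rintro ⟨rfl, rfl⟩; simp
    · rintro ⟨rfl, rfl⟩; simp
  rw [mul_apply, Finset.sum_eq_single (Function.update τ x a)]
  · simp only [siteUnit, of_apply, key]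
    by_cases h : τ x = b <;> simp [h]
  · intro υ _ h
    simp [siteUnit, key, h]
  · simp

lemma siteUnit_mul_siteUnit (x : Λ) (a b b' c : Fin (q x)) :
    siteUnit x a b * siteUnit x b' c = if b = b' then siteUnit x a c else 0 := by
  ext σ τ
  rw [siteUnit_mul_apply]
  by_cases h : b = b' <;> by_cases h' : σ x = a <;> simp [siteUnit, h, h']

lemma conjTranspose_siteUnit (x : Λ) (a b : Fin (q x)) :
    (siteUnit x a b)ᴴ = siteUnit x b a := by
  ext σ τ
  have key : (τ x = a ∧ σ = Function.update τ x b) ↔ (σ x = b ∧ τ = Function.update σ x a) := by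
    constructor
    · rintro ⟨rfl, rfl⟩; simp
    · rintro ⟨rfl, rfl⟩; simp
  simp only [siteUnit, conjTranspose_apply, of_apply, key]
  split_ifs <;> simp

lemma sum_siteUnit (x : Λ) : ∑ a, siteUnit x a a = (1 : Op Λ q) := by
  ext σ τ
  rw [Matrix.sum_apply, Finset.sum_eq_single (σ x)]
  · simp [siteUnit, one_apply, eq_comm]
  · intro b _ h
    simp [siteUnit, h.symm]
  · simp

lemma commute_siteUnit {x y : Λ} (h : x ≠ y) (a b : Fin (q x)) (a' b' : Fin (q y)) :
    Commute (siteUnit x a b) (siteUnit y a' b') := by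
  ext σ τ
  rw [siteUnit_mul_apply, siteUnit_mul_apply]
  simp only [siteUnit, of_apply, Function.update_of_ne h, Function.update_of_ne h.symm,
    Function.update_comm h]
  split_ifs <;> simp_all

/-- `O` acts trivially on the site `x`, that is, `O` commutes with all operators at `x`. -/
def trivialAt (x : Λ) : Submodule ℂ (Op Λ q) where
  carrier := {O | ∀ a b, Commute (siteUnit x a b) O}
  add_mem' h h' _ _ := (h _ _).add_right (h' _ _)
  zero_mem' _ _ := Commute.zero_right _
  smul_mem' c _ h _ _ := (h _ _).smul_right c

lemma isClosed_trivialAt (x : Λ) : IsClosed (trivialAt (q := q) x : Set (Op Λ q)) :=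
  Submodule.closed_of_finiteDimensional _

lemma mul_mem_trivialAt {x : Λ} {O P : Op Λ q} (hO : O ∈ trivialAt x) (hP : P ∈ trivialAt x) :
    O * P ∈ trivialAt x :=
  fun a b => (hO a b).mul_right (hP a b)

lemma conjTranspose_mem_trivialAt {x : Λ} {O : Op Λ q} (hO : O ∈ trivialAt x) :
    Oᴴ ∈ trivialAt x := by
  intro a b
  have := (hO b a).star_star
  rwa [star_eq_conjTranspose, star_eq_conjTranspose, conjTranspose_siteUnit] at this

lemma SupportedOn.mem_trivialAt {Z : Finset Λ} {A : Op Λ q} (h : SupportedOn Z A) {x : Λ}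
    (hx : x ∉ Z) : A ∈ trivialAt x := by
  obtain ⟨o, ho⟩ := h
  intro a b
  ext σ τ
  rw [siteUnit_mul_apply, mul_siteUnit_apply, ho, ho]
  have hne : ∀ y : Z, (y : Λ) ≠ x := fun y hy => hx (hy ▸ y.2)
  have h1 : (fun y : Z => Function.update σ x b y) = fun y : Z => σ y := by
    ext y; rw [Function.update_of_ne (hne y)]
  have h2 : (fun y : Z => Function.update τ x a y) = fun y : Z => τ y := by
    ext y; rw [Function.update_of_ne (hne y)]
  rw [h1, h2]
  by_cases hs : σ x = a
  · by_cases ht : τ x = b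
    · have : (∀ y, y ∉ Z → Function.update σ x b y = τ y) ↔
          ∀ y, y ∉ Z → σ y = Function.update τ x a y := by
        refine forall_congr' fun y => imp_congr_right fun _ => ?_
        rcases eq_or_ne y x with rfl | hy
        · simp [hs, ht]
        · simp [hy]
      simp only [hs, ht, this, if_true]
    · have : ¬ ∀ y, y ∉ Z → Function.update σ x b y = τ y := fun h => ht (by simpa using (h x hx).symm)
      rw [if_pos hs, if_neg this, if_neg ht]
  · by_cases ht : τ x = b
    · have : ¬ ∀ y, y ∉ Z → σ y = Function.update τ x a y := fun h => hs (by simpa using h x hx)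
      rw [if_neg hs, if_pos ht, if_neg this]
    · simp [hs, ht]

lemma apply_eq_zero_of_mem_trivialAt {x : Λ} {O : Op Λ q} (hO : O ∈ trivialAt x)
    {σ τ : Config Λ q} (h : σ x ≠ τ x) : O σ τ = 0 := by
  have := congrFun (congrFun (hO (σ x) (σ x)).eq σ) τ
  rw [siteUnit_mul_apply, mul_siteUnit_apply] at this
  simpa [h.symm] using this

lemma apply_update_of_mem_trivialAt {x : Λ} {O : Op Λ q} (hO : O ∈ trivialAt x)
    {σ τ : Config Λ q} (h : σ x = τ x) (c : Fin (q x)) :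
    O (Function.update σ x c) (Function.update τ x c) = O σ τ := by
  have := congrFun (congrFun (hO (σ x) c).eq σ) (Function.update τ x c)
  rw [siteUnit_mul_apply, mul_siteUnit_apply] at this
  simpa [h] using this

lemma apply_piecewise_of_mem_trivialAt {Z : Finset Λ} {O : Op Λ q}
    (hO : ∀ x ∈ Z, O ∈ trivialAt x) (ρ : Config Λ q) {σ τ : Config Λ q}
    (h : ∀ x ∈ Z, σ x = τ x) : O (Z.piecewise ρ σ) (Z.piecewise ρ τ) = O σ τ := by
  classical
  induction Z using Finset.induction_on with
  | empty => simp
  | insert x Z hx ih =>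
    rw [Finset.piecewise_insert, Finset.piecewise_insert,
      apply_update_of_mem_trivialAt (hO x (by simp)),
      ih (fun y hy => hO y (by simp [hy])) fun y hy => h y (by simp [hy])]
    simp [hx, h x]

/-- `A` cannot change the configuration off `Z`, nor `O` on `Z`, so each product has a single
contributing intermediate configuration. -/
lemma SupportedOn.commute {Z : Finset Λ} {A O : Op Λ q} (hA : SupportedOn Z A)
    (hO : ∀ x ∈ Z, O ∈ trivialAt x) : Commute A O := by
  obtain ⟨o, ho⟩ := hA
  ext σ τ
  rw [mul_apply, mul_apply, Finset.sum_eq_single (Z.piecewise τ σ),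
    Finset.sum_eq_single (Z.piecewise σ τ)]
  · have h1 : O (Z.piecewise τ σ) τ = O σ (Z.piecewise σ τ) := by
      have := apply_piecewise_of_mem_trivialAt hO τ (σ := σ) (τ := Z.piecewise σ τ)
        fun x hx => by simp [hx]
      rw [← this]
      congr 1
      ext x
      by_cases hx : x ∈ Z <;> simp [hx]
    have h2 : A σ (Z.piecewise τ σ) = A (Z.piecewise σ τ) τ := by
      rw [ho, ho, if_pos, if_pos]
      · congr 1
        · ext x; simp
        · ext x; simp
      · intro x hx; simp [hx]
      · intro x hx; simp [hx]
    rw [h1, h2, mul_comm]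
  · intro υ _ hυ
    by_cases h : ∃ x ∈ Z, σ x ≠ υ x
    · obtain ⟨x, hx, hne⟩ := h
      rw [apply_eq_zero_of_mem_trivialAt (hO x hx) hne, zero_mul]
    · push Not at h
      rw [ho υ τ, if_neg, mul_zero]
      intro h'
      refine hυ (funext fun x => ?_)
      by_cases hx : x ∈ Z
      · simp [hx, h x hx]
      · simp [hx, h' x hx]
  · simp
  · intro υ _ hυ
    by_cases h : ∃ x ∈ Z, υ x ≠ τ x
    · obtain ⟨x, hx, hne⟩ := h
      rw [apply_eq_zero_of_mem_trivialAt (hO x hx) hne, mul_zero]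
    · push Not at h
      rw [ho σ υ, if_neg, zero_mul]
      intro h'
      refine hυ (funext fun x => ?_)
      by_cases hx : x ∈ Z
      · simp [hx, h x hx]
      · simp [hx, h' x hx]
  · simp

/-- The conditional expectation `⟨a|O|a⟩ ⊗ 1` onto the operators acting trivially on the site `x`. -/
def siteProj (x : Λ) (a : Fin (q x)) (O : Op Λ q) : Op Λ q :=
  ∑ b, siteUnit x b a * O * siteUnit x a b

lemma siteProj_sub (x : Λ) (a : Fin (q x)) (O P : Op Λ q) :
    siteProj x a (O - P) = siteProj x a O - siteProj x a P := by
  simp [siteProj, mul_sub, sub_mul]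

lemma norm_siteProj_le (x : Λ) (a : Fin (q x)) (O : Op Λ q) : ‖siteProj x a O‖ ≤ ‖O‖ := by
  have h := norm_kraus_le Finset.univ (fun b => siteUnit x a b) O
  simp only [conjTranspose_siteUnit, siteUnit_mul_siteUnit, if_true, sum_siteUnit] at h
  refine h.trans ?_
  rcases isEmpty_or_nonempty (Config Λ q) with h | h
  · have : O = 0 := Subsingleton.elim _ _
    simp [this]
  · simp

lemma siteProj_eq_self {x : Λ} (a : Fin (q x)) {O : Op Λ q} (hO : O ∈ trivialAt x) :
    siteProj x a O = O := by
  have : ∀ b, siteUnit x b a * O * siteUnit x a b = siteUnit x b b * O := by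
    intro b
    rw [mul_assoc, ← (hO a b).eq, ← mul_assoc, siteUnit_mul_siteUnit, if_pos rfl]
  simp only [siteProj, this, ← Finset.sum_mul, sum_siteUnit, one_mul]

lemma siteProj_mem_trivialAt (x : Λ) (a : Fin (q x)) (O : Op Λ q) :
    siteProj x a O ∈ trivialAt x := by
  intro b c
  have h1 : siteUnit x b c * siteProj x a O = siteUnit x b a * O * siteUnit x a c := by
    rw [siteProj, Finset.mul_sum, Finset.sum_eq_single c]
    · rw [← mul_assoc, ← mul_assoc, siteUnit_mul_siteUnit, if_pos rfl]
    · intro e _ he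
      rw [← mul_assoc, ← mul_assoc, siteUnit_mul_siteUnit, if_neg he.symm, zero_mul, zero_mul]
    · simp
  have h2 : siteProj x a O * siteUnit x b c = siteUnit x b a * O * siteUnit x a c := by
    rw [siteProj, Finset.sum_mul, Finset.sum_eq_single b]
    · rw [mul_assoc, siteUnit_mul_siteUnit, if_pos rfl]
    · intro e _ he
      rw [mul_assoc, siteUnit_mul_siteUnit, if_neg he, mul_zero]
    · simp
  exact h1.trans h2.symm

lemma siteProj_mem_trivialAt_of_mem {x y : Λ} (a : Fin (q x)) {O : Op Λ q}
    (hO : O ∈ trivialAt y) : siteProj x a O ∈ trivialAt y := by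
  rcases eq_or_ne y x with rfl | h
  · exact siteProj_mem_trivialAt _ _ _
  · refine Submodule.sum_mem _ fun b _ => mul_mem_trivialAt (mul_mem_trivialAt ?_ hO) ?_
    · exact fun _ _ => commute_siteUnit h _ _ _ _
    · exact fun _ _ => commute_siteUnit h _ _ _ _

/-- How far `O` is from acting trivially on the site `x`. -/
noncomputable def variation (ω : Config Λ q) (x : Λ) (O : Op Λ q) : ℝ :=
  ‖O - siteProj x (ω x) O‖

lemma variation_nonneg (ω : Config Λ q) (x : Λ) (O : Op Λ q) : 0 ≤ variation ω x O :=
  norm_nonneg _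

lemma variation_le (ω : Config Λ q) (x : Λ) (O : Op Λ q) : variation ω x O ≤ 2 * ‖O‖ := by
  refine (norm_sub_le _ _).trans ?_
  linarith [norm_siteProj_le x (ω x) O]

/-- The projection fixes `P`, so `O` may be replaced by `O - P`. Thus the variation is comparable to
the distance from the operators trivial at `x`, and any convenient `P` bounds it. -/
lemma variation_le_of_mem (ω : Config Λ q) {x : Λ} (O : Op Λ q) {P : Op Λ q}
    (hP : P ∈ trivialAt x) : variation ω x O ≤ 2 * ‖O - P‖ := by
  have : O - siteProj x (ω x) O = (O - P) - siteProj x (ω x) (O - P) := by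
    rw [siteProj_sub, siteProj_eq_self _ hP]; abel
  rw [variation, this]
  exact variation_le ω x (O - P)

/-- Project the sites out one after another: each projection is a contraction and preserves
triviality elsewhere, so the errors simply add. -/
lemma exists_mem_trivialAt_norm_sub_le (ω : Config Λ q) (Z : Finset Λ) (O : Op Λ q) :
    ∃ P : Op Λ q, (∀ x ∈ Z, P ∈ trivialAt x) ∧ ‖O - P‖ ≤ ∑ x ∈ Z, variation ω x O := by
  classical
  induction Z using Finset.induction_on with
  | empty => exact ⟨O, by simp⟩
  | insert x Z hx ih =>
    obtain ⟨P, hP, hOP⟩ := ih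
    refine ⟨siteProj x (ω x) P, fun y hy => ?_, ?_⟩
    · rcases Finset.mem_insert.1 hy with rfl | hy
      · exact siteProj_mem_trivialAt _ _ _
      · exact siteProj_mem_trivialAt_of_mem _ (hP y hy)
    · rw [Finset.sum_insert hx]
      have : O - siteProj x (ω x) P = (O - siteProj x (ω x) O) + siteProj x (ω x) (O - P) := by
        rw [siteProj_sub]; abel
      rw [this]
      exact (norm_add_le _ _).trans (add_le_add le_rfl ((norm_siteProj_le _ _ _).trans hOP))

namespace LocalLiouvillian

variable {Z : Finset Λ} (M : LocalLiouvillian Λ q Z)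

lemma adjoint_apply (O : Op Λ q) :
    M.adjoint O = Complex.I • (M.ham * O - O * M.ham) +
      ∑ k, ((M.jump k)ᴴ * O * M.jump k -
        (1 / 2 : ℂ) • ((M.jump k)ᴴ * M.jump k * O + O * ((M.jump k)ᴴ * M.jump k))) := rfl

lemma isDissipative_adjoint : IsDissipative ⇑M.adjoint := by
  have h := (IsDissipative.add (E := Op Λ q) (G := fun O => Complex.I • (M.ham * O - O * M.ham))
    ⟨_, fun ε _ O => norm_commutator_step_le M.ham_isHermitian ε O⟩
    (IsDissipative.sum (E := Op Λ q) Finset.univ (G := fun k O => (M.jump k)ᴴ * O * M.jump k -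
        (1 / 2 : ℂ) • ((M.jump k)ᴴ * M.jump k * O + O * ((M.jump k)ᴴ * M.jump k)))
      fun k _ => ⟨_, fun ε hε O => norm_jump_step_le (M.jump k) hε O⟩))
  exact h

lemma adjoint_mem_trivialAt {x : Λ} (hx : x ∉ Z) {O : Op Λ q} (hO : O ∈ trivialAt x) :
    M.adjoint O ∈ trivialAt x := by
  have hH := M.ham_supportedOn.mem_trivialAt hx
  have hL := fun k => (M.jump_supportedOn k).mem_trivialAt hx
  have hL' := fun k => conjTranspose_mem_trivialAt (hL k)
  rw [adjoint_apply]
  refine Submodule.add_mem _ (Submodule.smul_mem _ _ (Submodule.sub_mem _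
    (mul_mem_trivialAt hH hO) (mul_mem_trivialAt hO hH))) (Submodule.sum_mem _ fun k _ => ?_)
  have hLL := mul_mem_trivialAt (hL' k) (hL k)
  exact Submodule.sub_mem _ (mul_mem_trivialAt (mul_mem_trivialAt (hL' k) hO) (hL k))
    (Submodule.smul_mem _ _ (Submodule.add_mem _ (mul_mem_trivialAt hLL hO)
      (mul_mem_trivialAt hO hLL)))

/-- `O` commutes with the Hamiltonian, the jumps and their adjoints, and the dissipator then
cancels. -/
lemma adjoint_eq_zero {O : Op Λ q} (hO : ∀ x ∈ Z, O ∈ trivialAt x) : M.adjoint O = 0 := by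
  have hH := (M.ham_supportedOn.commute hO).eq
  have hL := fun k => ((M.jump_supportedOn k).commute hO).eq
  have hL' : ∀ k, (M.jump k)ᴴ * O = O * (M.jump k)ᴴ := by
    intro k
    have := ((M.jump_supportedOn k).commute
      fun x hx => conjTranspose_mem_trivialAt (hO x hx)).star_star.eq
    simpa [star_eq_conjTranspose] using this
  rw [adjoint_apply, hH, sub_self, smul_zero, zero_add]
  refine Finset.sum_eq_zero fun k _ => ?_
  have h1 : (M.jump k)ᴴ * O * M.jump k = O * ((M.jump k)ᴴ * M.jump k) := by
    rw [hL', mul_assoc]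
  have h2 : (M.jump k)ᴴ * M.jump k * O = O * ((M.jump k)ᴴ * M.jump k) := by
    rw [mul_assoc, hL, ← mul_assoc, hL', mul_assoc]
  rw [h1, h2]
  module

lemma norm_adjoint_apply_le (ω : Config Λ q) (O : Op Λ q) :
    ‖M.adjoint O‖ ≤ ‖M.adjoint‖ * ∑ x ∈ Z, variation ω x O := by
  obtain ⟨P, hP, hOP⟩ := exists_mem_trivialAt_norm_sub_le ω Z O
  have : M.adjoint O = M.adjoint (O - P) := by
    rw [map_sub, M.adjoint_eq_zero hP, sub_zero]
  rw [this]
  exact (M.adjoint.le_opNorm _).trans (mul_le_mul_of_nonneg_left hOP (norm_nonneg _))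

end LocalLiouvillian

namespace Liouvillian

/-- The part of the adjoint Liouvillian that consists of the terms indexed by `𝒵`. -/
noncomputable def partialAdjoint (ℒ : Liouvillian Λ q) (𝒵 : Finset (Finset Λ)) :
    Op Λ q →L[ℂ] Op Λ q :=
  ∑ Z ∈ 𝒵, (ℒ Z).adjoint

variable (ℒ : Liouvillian Λ q)

lemma partialAdjoint_apply (𝒵 : Finset (Finset Λ)) (O : Op Λ q) :
    ℒ.partialAdjoint 𝒵 O = ∑ Z ∈ 𝒵, (ℒ Z).adjoint O := by
  simp [partialAdjoint]

lemma isDissipative_partialAdjoint (𝒵 : Finset (Finset Λ)) :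
    IsDissipative ⇑(ℒ.partialAdjoint 𝒵) := by
  have := IsDissipative.sum 𝒵 fun Z _ => (ℒ Z).isDissipative_adjoint
  convert this using 1
  ext1 O
  exact ℒ.partialAdjoint_apply 𝒵 O

lemma isDissipative_adjointOn (S : Finset Λ) : IsDissipative ⇑(ℒ.adjointOn S) :=
  ℒ.isDissipative_partialAdjoint S.powerset

/-- Terms on `{x}` alone annihilate operators trivial at `x` and may stay in the generator. This
matters because the long-range condition does not bound single-site terms. -/
lemma semigroup_partialAdjoint_mem_trivialAt {𝒵 : Finset (Finset Λ)} {x : Λ}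
    (h𝒵 : ∀ Z ∈ 𝒵, x ∈ Z → Z = {x}) (t : ℝ) {O : Op Λ q} (hO : O ∈ trivialAt x) :
    semigroup (ℒ.partialAdjoint 𝒵) t O ∈ trivialAt x := by
  refine semigroup_mem_of_invariant (isClosed_trivialAt x) (fun P hP => ?_) t hO
  rw [partialAdjoint_apply]
  refine Submodule.sum_mem _ fun Z hZ => ?_
  by_cases hx : x ∈ Z
  · rw [(ℒ Z).adjoint_eq_zero]
    · exact Submodule.zero_mem _
    · intro y hy
      rw [h𝒵 Z hZ hx, Finset.mem_singleton] at hy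
      rwa [hy]
  · exact (ℒ Z).adjoint_mem_trivialAt hx hP

lemma semigroup_adjointOn_mem_trivialAt {S : Finset Λ} {x : Λ} (hx : x ∉ S) (t : ℝ) {O : Op Λ q}
    (hO : O ∈ trivialAt x) : semigroup (ℒ.adjointOn S) t O ∈ trivialAt x :=
  ℒ.semigroup_partialAdjoint_mem_trivialAt
    (fun _ hZ hxZ => absurd (Finset.mem_powerset.1 hZ hxZ) hx) t hO

end Liouvillian

end Observables

/-! ### A comparison principle for systems of integral inequalities -/

section Comparison

/-- Grönwall's argument by Picard iteration: starting from the crude bound `M`, each use of the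
inequality halves the excess over the supersolution `w`. The integral inequality is stated through
arbitrary antiderivatives `B`, so no measurability of `D` is required. -/
lemma le_of_integral_inequality {ι : Type*} [Fintype ι] {Y : Finset ι} {G : ι → ι → ℝ}
    {D w w' : ι → ℝ → ℝ} {M : ℝ} (hG : ∀ i j, 0 ≤ G i j)
    (hDM : ∀ i s, 0 ≤ s → D i s ≤ M) (hw : ∀ i s, HasDerivAt (w i) (w' i s) s)
    (hw0 : ∀ i s, 0 ≤ s → 0 ≤ w i s)
    (hsuper : ∀ i, i ∉ Y → ∀ s, 0 ≤ s → ∑ j, G i j * w j s ≤ w' i s)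
    (hY : ∀ i ∈ Y, ∀ s, 0 ≤ s → D i s ≤ w i s)
    (hD : ∀ i, i ∉ Y → ∀ B B' : ℝ → ℝ, (∀ s, HasDerivAt B (B' s) s) →
      (∀ s, 0 ≤ s → ∑ j, G i j * D j s ≤ B' s) → ∀ t, 0 ≤ t → D i t ≤ B t - B 0)
    (i : ι) {t : ℝ} (ht : 0 ≤ t) : D i t ≤ w i t := by
  -- Every row sum is at most `l / 2`, so integrating the weight `e^{ls}` gains the factor `1 / 2`.
  set l : ℝ := 2 * ∑ i, ∑ j, G i j with hl
  have hrow : ∀ i, ∑ j, G i j ≤ l / 2 := by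
    intro i
    rw [hl, mul_div_cancel_left₀ _ two_ne_zero]
    exact Finset.single_le_sum (f := fun i => ∑ j, G i j)
      (fun i _ => Finset.sum_nonneg fun j _ => hG i j) (Finset.mem_univ i)
  have hl0 : 0 ≤ l := by
    rw [hl]
    exact mul_nonneg zero_le_two (Finset.sum_nonneg fun i _ => Finset.sum_nonneg fun j _ => hG i j)
  set m := max M 0 with hm
  have hm0 : 0 ≤ m := le_max_right _ _
  have claim : ∀ n : ℕ, ∀ i s, 0 ≤ s → D i s ≤ w i s + m / 2 ^ n * Real.exp (l * s) := by
    intro n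
    induction n with
    | zero =>
      intro i s hs
      have h1 : m ≤ m * Real.exp (l * s) :=
        le_mul_of_one_le_right hm0 (Real.one_le_exp (by positivity))
      have := hDM i s hs
      have := hw0 i s hs
      have := le_max_left M 0
      rw [pow_zero, div_one]
      linarith
    | succ n ih =>
      intro i s hs
      by_cases hi : i ∈ Y
      · have := hY i hi s hs
        have : 0 ≤ m / 2 ^ (n + 1) * Real.exp (l * s) := by positivity
        linarith
      · have hB : ∀ s, HasDerivAt (fun s => w i s + m / 2 ^ (n + 1) * Real.exp (l * s))
            (w' i s + m / 2 ^ (n + 1) * (Real.exp (l * s) * l)) s := by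
          intro s
          refine (hw i s).add (HasDerivAt.const_mul _ ?_)
          simpa using ((hasDerivAt_id s).const_mul l).exp
        have := hD i hi _ _ hB (fun s hs => ?_) s hs
        · have h0 := hw0 i 0 le_rfl
          have h1 : 0 ≤ m / 2 ^ (n + 1) * Real.exp (l * 0) := by positivity
          linarith
        · calc ∑ j, G i j * D j s ≤ ∑ j, G i j * (w j s + m / 2 ^ n * Real.exp (l * s)) :=
                Finset.sum_le_sum fun j _ => mul_le_mul_of_nonneg_left (ih j s hs) (hG i j)
            _ = ∑ j, G i j * w j s + (∑ j, G i j) * (m / 2 ^ n * Real.exp (l * s)) := by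
                rw [Finset.sum_mul, ← Finset.sum_add_distrib]
                exact Finset.sum_congr rfl fun j _ => by ring
            _ ≤ w' i s + l / 2 * (m / 2 ^ n * Real.exp (l * s)) :=
                add_le_add (hsuper i hi s hs)
                  (mul_le_mul_of_nonneg_right (hrow i) (by positivity))
            _ = _ := by rw [pow_succ]; field_simp
  have hlim : Filter.Tendsto (fun n : ℕ => w i t + m / 2 ^ n * Real.exp (l * t)) Filter.atTop
      (nhds (w i t)) := by
    have h1 : Filter.Tendsto (fun n : ℕ => m / 2 ^ n) Filter.atTop (nhds 0) :=
      Filter.Tendsto.const_div_atTop (tendsto_pow_atTop_atTop_of_one_lt one_lt_two) m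
    simpa using (h1.mul_const (Real.exp (l * t))).const_add (w i t)
  exact ge_of_tendsto' hlim fun n => claim n i t ht

end Comparison

/-! ### Lattice distance and the decay function -/

section Decay

variable {d : ℕ}

lemma siteDist_eq_dist (i j : Fin d → ℤ) :
    siteDist i j = dist (WithLp.toLp 2 fun k => (i k : ℝ)) (WithLp.toLp 2 fun k => (j k : ℝ)) := by
  rw [siteDist, EuclideanSpace.dist_eq]
  simp [Real.dist_eq, sq_abs]

lemma siteDist_nonneg (i j : Fin d → ℤ) : 0 ≤ siteDist i j := Real.sqrt_nonneg _

lemma siteDist_comm (i j : Fin d → ℤ) : siteDist i j = siteDist j i := by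
  rw [siteDist_eq_dist, siteDist_eq_dist, dist_comm]

@[simp] lemma siteDist_self (i : Fin d → ℤ) : siteDist i i = 0 := by
  rw [siteDist_eq_dist, dist_self]

lemma siteDist_triangle (i j k : Fin d → ℤ) : siteDist i k ≤ siteDist i j + siteDist j k := by
  simp only [siteDist_eq_dist]
  exact dist_triangle _ _ _

lemma abs_sub_le_siteDist (i j : Fin d → ℤ) (k : Fin d) : |(i k : ℝ) - j k| ≤ siteDist i j := by
  rw [← Real.sqrt_sq_eq_abs]
  exact Real.sqrt_le_sqrt (Finset.single_le_sum (f := fun k => ((i k : ℝ) - j k) ^ 2)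
    (fun k _ => sq_nonneg _) (Finset.mem_univ k))

lemma one_le_siteDist {i j : Fin d → ℤ} (h : i ≠ j) : 1 ≤ siteDist i j := by
  obtain ⟨k, hk⟩ := Function.ne_iff.1 h
  refine le_trans ?_ (abs_sub_le_siteDist i j k)
  have : 1 ≤ |i k - j k| := Int.one_le_abs (sub_ne_zero.2 hk)
  exact_mod_cast this

/-- The decay function `(1 + dist(i, j))^{-α}`. -/
noncomputable def decay (α : ℝ) (i j : Fin d → ℤ) : ℝ := (1 + siteDist i j) ^ (-α)

lemma decay_pos (α : ℝ) (i j : Fin d → ℤ) : 0 < decay α i j :=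
  Real.rpow_pos_of_pos (by linarith [siteDist_nonneg i j]) _

lemma decay_comm (α : ℝ) (i j : Fin d → ℤ) : decay α i j = decay α j i := by
  rw [decay, decay, siteDist_comm]

lemma one_div_siteDist_rpow_le {α : ℝ} (hα : 0 < α) {i j : Fin d → ℤ} (h : i ≠ j) :
    1 / siteDist i j ^ α ≤ 2 ^ α * decay α i j := by
  have h1 := one_le_siteDist h
  rw [decay, Real.rpow_neg (by linarith), ← div_eq_mul_inv, ← Real.div_rpow (by norm_num)
    (by linarith), one_div, ← Real.inv_rpow (by linarith)]
  refine Real.rpow_le_rpow (by positivity) ?_ hα.le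
  rw [inv_le_comm₀ (by linarith) (by positivity), inv_div]
  linarith

/-- By the triangle inequality the longer of the two legs has at least half the length of `i` to
`k`, and the shorter leg keeps its own factor. -/
lemma decay_mul_decay_le {α : ℝ} (hα : 0 < α) (i j k : Fin d → ℤ) :
    decay α i j * decay α j k ≤ 2 ^ α * decay α i k * (decay α i j + decay α j k) := by
  have key : ∀ x y z : ℝ, 1 ≤ x → 1 ≤ y → 1 ≤ z → z ≤ 2 * x →
      x ^ (-α) * y ^ (-α) ≤ 2 ^ α * z ^ (-α) * y ^ (-α) := by
    intro x y z hx hy hz h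
    refine mul_le_mul_of_nonneg_right ?_ (by positivity)
    have h2 : (2 * x) ^ (-α) ≤ z ^ (-α) :=
      Real.rpow_le_rpow_of_nonpos (by linarith) h (by linarith)
    rw [Real.mul_rpow (by norm_num) (by linarith), Real.rpow_neg (by norm_num)] at h2
    have h3 : (0 : ℝ) < 2 ^ α := by positivity
    calc x ^ (-α) = 2 ^ α * ((2 ^ α)⁻¹ * x ^ (-α)) := by field_simp
      _ ≤ _ := mul_le_mul_of_nonneg_left h2 h3.le
  have hij := siteDist_nonneg i j
  have hjk := siteDist_nonneg j k
  have hik := siteDist_nonneg i k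
  have htri := siteDist_triangle i j k
  have p1 := decay_pos α i j
  have p2 := decay_pos α j k
  have p3 := decay_pos α i k
  have p4 : (0 : ℝ) < 2 ^ α := by positivity
  rw [mul_add]
  rcases le_total (siteDist i j) (siteDist j k) with h | h
  · have := key (1 + siteDist j k) (1 + siteDist i j) (1 + siteDist i k) (by linarith)
      (by linarith) (by linarith) (by linarith)
    have h5 : 0 ≤ 2 ^ α * decay α i k * decay α j k := by positivity
    unfold decay at *
    linarith
  · have := key (1 + siteDist i j) (1 + siteDist j k) (1 + siteDist i k) (by linarith)
      (by linarith) (by linarith) (by linarith)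
    have h5 : 0 ≤ 2 ^ α * decay α i k * decay α i j := by positivity
    unfold decay at *
    linarith

/-- Reproducibility of the decay function. It holds for all `α > 0`; the dependence on the regime is
entirely in `Γ`. -/
lemma sum_decay_mul_decay_le {α : ℝ} (hα : 0 < α) {Λ : Finset (Fin d → ℤ)} {Γ : ℝ}
    (hΓ : ∀ i : Λ, ∑ j : Λ, decay α i.1 j.1 ≤ Γ) (i k : Λ) :
    ∑ j : Λ, decay α i.1 j.1 * decay α j.1 k.1 ≤ 2 ^ (α + 1) * Γ * decay α i.1 k.1 := by
  calc ∑ j : Λ, decay α i.1 j.1 * decay α j.1 k.1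
      ≤ ∑ j : Λ, 2 ^ α * decay α i.1 k.1 * (decay α i.1 j.1 + decay α k.1 j.1) :=
        Finset.sum_le_sum fun j _ => by
          have := decay_mul_decay_le hα i.1 j.1 k.1
          rwa [decay_comm α j.1 k.1] at this ⊢
    _ = 2 ^ α * decay α i.1 k.1 * (∑ j : Λ, decay α i.1 j.1 + ∑ j : Λ, decay α k.1 j.1) := by
        rw [← Finset.mul_sum, Finset.sum_add_distrib]
    _ ≤ 2 ^ α * decay α i.1 k.1 * (Γ + Γ) :=
        mul_le_mul_of_nonneg_left (add_le_add (hΓ i) (hΓ k))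
          (mul_nonneg (by positivity) (decay_pos _ _ _).le)
    _ = _ := by rw [Real.rpow_add (by norm_num), Real.rpow_one]; ring

/-- The growth rate per unit of the row sum of the decay function. -/
noncomputable def growthRate (α : ℝ) : ℝ := 2 ^ (2 * α + 3)

lemma growthRate_pos (α : ℝ) : 0 < growthRate α := Real.rpow_pos_of_pos two_pos _

end Decay

/-! ### The Lieb–Robinson bound for long-range Liouvillians -/

section Coupling

open Classical

variable {d : ℕ} {Λ : Finset (Fin d → ℤ)} {q : Λ → ℕ}

namespace Liouvillian

variable (ℒ : Liouvillian Λ q)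

/-- The total strength of the terms that couple `i` to `j`; for `i = j`, of the terms that couple `i`
to any other site. -/
noncomputable def coupling (i j : Λ) : ℝ :=
  ∑ Z with i ∈ Z ∧ j ∈ Z ∧ 2 ≤ Z.card, ‖(ℒ Z).adjoint‖

lemma coupling_nonneg (i j : Λ) : 0 ≤ ℒ.coupling i j :=
  Finset.sum_nonneg fun _ _ => norm_nonneg _

/-- Exchanging the sums turns many-body terms into a pair matrix, with no loss depending on the size
of the supports. -/
lemma sum_coupling_mul (i : Λ) (v : Λ → ℝ) :
    ∑ j, ℒ.coupling i j * v j =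
      ∑ Z with i ∈ Z ∧ 2 ≤ Z.card, ‖(ℒ Z).adjoint‖ * ∑ j ∈ Z, v j := by
  simp only [coupling, Finset.sum_filter, Finset.sum_mul, ite_mul, zero_mul, Finset.mul_sum]
  rw [Finset.sum_comm]
  refine Finset.sum_congr rfl fun Z _ => ?_
  by_cases h : i ∈ Z ∧ 2 ≤ Z.card
  · simp only [h.1, h.2, true_and, and_true, if_true]
    rw [← Finset.sum_filter]
    exact Finset.sum_congr (by ext; simp) fun _ _ => rfl
  · rw [if_neg h]
    refine Finset.sum_eq_zero fun j _ => if_neg ?_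
    tauto

variable {ℒ} {α : ℝ}

lemma IsLongRange.coupling_le (h : ℒ.IsLongRange α) (hα : 0 < α) {i j : Λ} (hij : i ≠ j) :
    ℒ.coupling i j ≤ 2 ^ α * decay α i.1 j.1 := by
  refine le_trans ?_ ((h i j hij).trans (one_div_siteDist_rpow_le hα (Subtype.coe_ne_coe.2 hij)))
  refine Finset.sum_le_sum_of_subset_of_nonneg (fun Z hZ => ?_) fun _ _ _ => norm_nonneg _
  simp only [Finset.mem_filter_univ] at hZ ⊢
  exact ⟨hZ.1, hZ.2.1⟩

/-- Each term counted on the diagonal contains some other site `j`, so it is also counted in an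
off-diagonal entry of the row. -/
lemma IsLongRange.coupling_self_le (h : ℒ.IsLongRange α) (hα : 0 < α) (i : Λ) :
    ℒ.coupling i i ≤ 2 ^ α * ∑ j : Λ, decay α i.1 j.1 := by
  have h1 : ℒ.coupling i i ≤ ∑ j, ℒ.coupling i j * if j = i then 0 else 1 := by
    rw [sum_coupling_mul, coupling]
    simp only [← and_assoc, and_self]
    refine Finset.sum_le_sum fun Z hZ => le_mul_of_one_le_right (norm_nonneg _) ?_
    rw [Finset.mem_filter_univ] at hZ
    obtain ⟨j, hj, hji⟩ := Finset.exists_mem_ne hZ.2 i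
    have := Finset.single_le_sum (f := fun j => if j = i then (0 : ℝ) else 1)
      (fun j _ => by positivity) hj
    simpa [hji] using this
  refine h1.trans ?_
  rw [Finset.mul_sum]
  refine Finset.sum_le_sum fun j _ => ?_
  split_ifs with hj
  · rw [mul_zero]
    exact mul_nonneg (by positivity) (decay_pos _ _ _).le
  · rw [mul_one]
    exact h.coupling_le hα (Ne.symm hj)

lemma IsLongRange.sum_coupling_mul_decay_le (h : ℒ.IsLongRange α) (hα : 0 < α) {Γ : ℝ}
    (hΓ : ∀ i : Λ, ∑ j : Λ, decay α i.1 j.1 ≤ Γ) (i k : Λ) :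
    ∑ j, ℒ.coupling i j * decay α j.1 k.1 ≤ 2 ^ (2 * α + 2) * Γ * decay α i.1 k.1 := by
  have p := decay_pos α i.1 k.1
  have hΓ0 : 0 ≤ Γ := (Finset.sum_nonneg fun j _ => (decay_pos _ _ _).le).trans (hΓ i)
  have h2 : ∀ j, ℒ.coupling i j * decay α j.1 k.1 ≤
      2 ^ α * (decay α i.1 j.1 * decay α j.1 k.1) +
        if j = i then 2 ^ α * Γ * decay α j.1 k.1 else 0 := by
    intro j
    have pj := decay_pos α j.1 k.1
    split_ifs with hj
    · subst hj
      have := mul_le_mul_of_nonneg_right ((h.coupling_self_le hα j).trans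
        (mul_le_mul_of_nonneg_left (hΓ j) (by positivity))) pj.le
      have : 0 ≤ (2 : ℝ) ^ α * (decay α j.1 j.1 * decay α j.1 k.1) :=
        mul_nonneg (by positivity) (mul_nonneg (decay_pos _ _ _).le pj.le)
      linarith
    · have := mul_le_mul_of_nonneg_right (h.coupling_le hα (Ne.symm hj)) pj.le
      linarith
  refine (Finset.sum_le_sum fun j _ => h2 j).trans ?_
  rw [Finset.sum_add_distrib, ← Finset.mul_sum, Finset.sum_ite_eq' Finset.univ i]
  simp only [Finset.mem_univ, if_true]
  have h3 := mul_le_mul_of_nonneg_left (sum_decay_mul_decay_le hα hΓ i k)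
    (by positivity : (0 : ℝ) ≤ 2 ^ α)
  have e1 : (2 : ℝ) ^ (2 * α + 2) = 4 * (2 ^ α * 2 ^ α) := by
    rw [Real.rpow_add (by norm_num), two_mul, Real.rpow_add (by norm_num)]
    norm_num; ring
  have e2 : (2 : ℝ) ^ (α + 1) = 2 * 2 ^ α := by
    rw [Real.rpow_add (by norm_num), Real.rpow_one]; ring
  have e3 : (1 : ℝ) ≤ 2 ^ α := Real.one_le_rpow (by norm_num) hα.le
  rw [e1]
  rw [e2] at h3
  have h4 : 2 ^ α * Γ * decay α i.1 k.1 ≤ 2 * (2 ^ α * 2 ^ α) * Γ * decay α i.1 k.1 := by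
    gcongr
    nlinarith
  nlinarith

variable (ℒ)

/-- The reference dynamics omits the terms coupling `i` to other sites and keeps `O` trivial at `i`.
Duhamel's formula charges the omitted terms to the variations of the true evolution. -/
lemma variation_semigroup_le (ω : Config Λ q) (S : Finset Λ) {O : Op Λ q} {i : Λ}
    (hi : O ∈ trivialAt i) {B B' : ℝ → ℝ} (hB : ∀ s, HasDerivAt B (B' s) s)
    (h : ∀ s, 0 ≤ s →
      ∑ j, ℒ.coupling i j * variation ω j (semigroup (ℒ.adjointOn S) s O) ≤ B' s)
    {t : ℝ} (ht : 0 ≤ t) :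
    variation ω i (semigroup (ℒ.adjointOn S) t O) ≤ 2 * (B t - B 0) := by
  set p : Finset Λ → Prop := fun Z => i ∈ Z → Z = {i} with hp
  set H := ℒ.partialAdjoint (S.powerset.filter p) with hH
  have hmem : semigroup H t O ∈ trivialAt i :=
    ℒ.semigroup_partialAdjoint_mem_trivialAt (fun Z hZ => (Finset.mem_filter.1 hZ).2) t hi
  refine (variation_le_of_mem ω _ hmem).trans (mul_le_mul_of_nonneg_left ?_ zero_le_two)
  rw [norm_sub_rev]
  refine norm_semigroup_sub_le (ℒ.isDissipative_partialAdjoint _) hB ht fun s hs _ => ?_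
  refine le_trans ?_ (h s hs)
  set Q := semigroup (ℒ.adjointOn S) s O
  have e : (H - ℒ.adjointOn S) Q = -∑ Z ∈ S.powerset.filter (fun Z => ¬ p Z), (ℒ Z).adjoint Q := by
    have : ℒ.adjointOn S = H + ℒ.partialAdjoint (S.powerset.filter fun Z => ¬ p Z) :=
      (Finset.sum_filter_add_sum_filter_not _ _ _).symm
    rw [this, ← partialAdjoint_apply]
    simp
  rw [e, norm_neg, sum_coupling_mul]
  refine (norm_sum_le_of_le _ fun Z _ => (ℒ Z).norm_adjoint_apply_le ω Q).trans ?_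
  refine Finset.sum_le_sum_of_subset_of_nonneg (fun Z hZ => ?_) fun Z _ _ =>
    mul_nonneg (norm_nonneg _) (Finset.sum_nonneg fun _ _ => variation_nonneg _ _ _)
  simp only [hp, Finset.mem_filter, Classical.not_imp] at hZ
  rw [Finset.mem_filter_univ]
  refine ⟨hZ.2.1, ?_⟩
  by_contra hc
  refine hZ.2.2 (Finset.eq_singleton_iff_unique_mem.2 ⟨hZ.2.1, fun y hy => ?_⟩)
  exact Finset.card_le_one.1 (by omega) _ hy _ hZ.2.1

/-- Every dropped term contains a site `j` outside `W` and is charged to it. If `j` is its only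
site, the term annihilates `Q`. -/
lemma norm_adjointOn_sub_apply_le (ω : Config Λ q) (S W : Finset Λ) {Q : Op Λ q}
    (hQ : ∀ x, x ∉ W → Q ∈ trivialAt x) :
    ‖(ℒ.adjointOn S - ℒ.adjointOn (S ∩ W)) Q‖ ≤
      ∑ j ∈ Wᶜ, ∑ i, ℒ.coupling j i * variation ω i Q := by
  have e : (ℒ.adjointOn S - ℒ.adjointOn (S ∩ W)) Q =
      ∑ Z ∈ S.powerset.filter (fun Z => ¬ Z ⊆ W), (ℒ Z).adjoint Q := by
    have : ℒ.adjointOn S = ℒ.adjointOn (S ∩ W) +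
        ℒ.partialAdjoint (S.powerset.filter fun Z => ¬ Z ⊆ W) := by
      have h1 : (S ∩ W).powerset = S.powerset.filter fun Z => Z ⊆ W := by
        ext Z
        rw [Finset.mem_powerset, Finset.mem_filter, Finset.mem_powerset, Finset.subset_inter_iff]
      unfold adjointOn partialAdjoint
      rw [h1]
      exact (Finset.sum_filter_add_sum_filter_not _ _ _).symm
    rw [this, ← partialAdjoint_apply]
    simp
  rw [e]
  set f : Finset Λ → ℝ := fun Z => ‖(ℒ Z).adjoint‖ * ∑ j ∈ Z, variation ω j Q with hf
  have hf0 : ∀ Z, 0 ≤ f Z := fun Z =>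
    mul_nonneg (norm_nonneg _) (Finset.sum_nonneg fun _ _ => variation_nonneg _ _ _)
  have hZ : ∀ Z ∈ S.powerset.filter (fun Z => ¬ Z ⊆ W),
      ‖(ℒ Z).adjoint Q‖ ≤ ∑ j ∈ Wᶜ, if j ∈ Z ∧ 2 ≤ Z.card then f Z else 0 := by
    intro Z hZ
    obtain ⟨j, hjZ, hjW⟩ := Finset.not_subset.1 (Finset.mem_filter.1 hZ).2
    have hnn : ∀ j ∈ Wᶜ, 0 ≤ if j ∈ Z ∧ 2 ≤ Z.card then f Z else 0 := by
      intro j _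
      split_ifs
      · exact hf0 Z
      · exact le_rfl
    by_cases hc : 2 ≤ Z.card
    · refine ((ℒ Z).norm_adjoint_apply_le ω Q).trans ?_
      have := Finset.single_le_sum hnn (Finset.mem_compl.2 hjW)
      rwa [if_pos ⟨hjZ, hc⟩] at this
    · rw [(ℒ Z).adjoint_eq_zero fun x hx => ?_, norm_zero]
      · exact Finset.sum_nonneg hnn
      · rw [Finset.card_le_one.1 (by omega) _ hx _ hjZ]
        exact hQ j hjW
  refine (norm_sum_le_of_le _ hZ).trans ?_
  rw [Finset.sum_comm]
  refine Finset.sum_le_sum fun j _ => ?_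
  rw [sum_coupling_mul, ← Finset.sum_filter]
  refine Finset.sum_le_sum_of_subset_of_nonneg (fun Z hZ => ?_) fun Z _ _ => hf0 Z
  rw [Finset.mem_filter_univ]
  exact (Finset.mem_filter.1 hZ).2

/-- Error of restricting the dynamics to `W`, for an operator that is supported on `Y ⊆ W`. -/
theorem norm_semigroup_adjointOn_sub_le {ℒ : Liouvillian Λ q} (h : ℒ.IsLongRange α) (hα : 0 < α)
    {Γ : ℝ} (hΓ0 : 0 < Γ) (hΓ : ∀ i : Λ, ∑ j : Λ, decay α i.1 j.1 ≤ Γ) (S : Finset Λ)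
    {W Y : Finset Λ} (hYW : Y ⊆ W) {O : Op Λ q} (hO : ∀ x, x ∉ Y → O ∈ trivialAt x) {t : ℝ}
    (ht : 0 ≤ t) :
    ‖semigroup (ℒ.adjointOn S) t O - semigroup (ℒ.adjointOn (S ∩ W)) t O‖ ≤
      2 ^ (α + 1) * ‖O‖ * ((Real.exp (growthRate α * Γ * t) - 1) / (growthRate α * Γ)) *
        ∑ j ∈ Wᶜ, ∑ k ∈ Y, decay α j.1 k.1 := by
  -- The projections need a reference level at each site; without any configuration all operators
  -- vanish.
  rcases isEmpty_or_nonempty (Config Λ q) with hemp | ⟨⟨ω⟩⟩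
  · have : O = 0 := Subsingleton.elim _ _
    simp [this]
  set J := growthRate α * Γ with hJ
  have hJ0 : 0 < J := mul_pos (growthRate_pos α) hΓ0
  set F : Λ → ℝ := fun i => ∑ k ∈ Y, decay α i.1 k.1 with hF
  have hF0 : ∀ i, 0 ≤ F i := fun i => Finset.sum_nonneg fun k _ => (decay_pos _ _ _).le
  -- `u` bounds the rate at which sites of `Y`, with their maximal variation `2‖O‖`, feed site `i`.
  -- As `g' = 1 + J g`, the barrier `u i * g s` off `Y` is a supersolution.
  set u : Λ → ℝ := fun i => 2 ^ (α + 2) * ‖O‖ * F i with hu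
  have hu0 : ∀ i, 0 ≤ u i := fun i => mul_nonneg (by positivity) (hF0 i)
  set g : ℝ → ℝ := fun s => (Real.exp (J * s) - 1) / J with hg
  have hg0 : ∀ s, 0 ≤ s → 0 ≤ g s := fun s hs =>
    div_nonneg (sub_nonneg.2 (Real.one_le_exp (by positivity))) hJ0.le
  have hg' : ∀ s, HasDerivAt g (Real.exp (J * s)) s := by
    intro s
    have := ((((hasDerivAt_id s).const_mul J).exp).sub_const 1).div_const J
    simpa [hJ0.ne'] using this
  have hgJ : ∀ s, J * g s = Real.exp (J * s) - 1 := fun s => mul_div_cancel₀ _ hJ0.ne'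
  set w : Λ → ℝ → ℝ := fun i s => if i ∈ Y then 2 * ‖O‖ else u i * g s with hw
  set w' : Λ → ℝ → ℝ := fun i s => if i ∈ Y then 0 else u i * Real.exp (J * s) with hw'
  set T := S ∩ W with hT
  set Q : ℝ → Op Λ q := fun s => semigroup (ℒ.adjointOn T) s O with hQ
  have hQn : ∀ s, 0 ≤ s → ‖Q s‖ ≤ ‖O‖ := fun s hs =>
    (ℒ.isDissipative_adjointOn T).norm_semigroup_apply_le hs O
  have hvar : ∀ i s, 0 ≤ s → variation ω i (Q s) ≤ 2 * ‖O‖ := fun i s hs =>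
    (variation_le ω i _).trans (mul_le_mul_of_nonneg_left (hQn s hs) zero_le_two)
  have hsuper : ∀ i, i ∉ Y → ∀ s, 0 ≤ s → ∑ j, 2 * ℒ.coupling i j * w j s ≤
      u i * Real.exp (J * s) := by
    intro i hi s hs
    have h1 : ∀ j, 2 * ℒ.coupling i j * w j s ≤
        (if j ∈ Y then 2 ^ (α + 2) * ‖O‖ * decay α i.1 j.1 else 0) +
          2 * ℒ.coupling i j * (u j * g s) := by
      intro j
      have hc := ℒ.coupling_nonneg i j
      by_cases hj : j ∈ Y
      · have h3 : 0 ≤ 2 * ℒ.coupling i j * (u j * g s) :=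
          mul_nonneg (by positivity) (mul_nonneg (hu0 j) (hg0 s hs))
        have h4 := h.coupling_le hα (show i ≠ j from fun e => hi (e ▸ hj))
        have e : (2 : ℝ) ^ (α + 2) = 4 * 2 ^ α := by
          rw [Real.rpow_add two_pos]; norm_num; ring
        simp only [hw, hj, if_true, e]
        nlinarith [mul_le_mul_of_nonneg_right h4 (norm_nonneg O)]
      · simp [hw, hj]
    refine (Finset.sum_le_sum fun j _ => h1 j).trans ?_
    rw [Finset.sum_add_distrib, ← Finset.sum_filter, Finset.filter_mem_eq_inter,
      Finset.univ_inter, ← Finset.mul_sum]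
    have h2 : ∑ j, 2 * ℒ.coupling i j * (u j * g s) ≤ J * u i * g s := by
      have e1 : ∑ j, 2 * ℒ.coupling i j * (u j * g s) =
          2 ^ (α + 2) * ‖O‖ * g s * 2 * ∑ k ∈ Y, ∑ j, ℒ.coupling i j * decay α j.1 k.1 := by
        rw [Finset.sum_comm, Finset.mul_sum]
        refine Finset.sum_congr rfl fun j _ => ?_
        rw [← Finset.mul_sum]
        simp only [hu, hF]
        ring
      have e2 : J * u i * g s = 2 ^ (α + 2) * ‖O‖ * g s * 2 *
          ∑ k ∈ Y, 2 ^ (2 * α + 2) * Γ * decay α i.1 k.1 := by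
        have : growthRate α = 2 * 2 ^ (2 * α + 2) := by
          rw [growthRate, show 2 * α + 3 = 1 + (2 * α + 2) by ring, Real.rpow_add two_pos,
            Real.rpow_one]
        rw [← Finset.mul_sum]
        simp only [hu, hF, hJ, this]
        ring
      rw [e1, e2]
      refine mul_le_mul_of_nonneg_left (Finset.sum_le_sum fun k _ =>
        h.sum_coupling_mul_decay_le hα hΓ i k) ?_
      have := hg0 s hs
      positivity
    calc _ ≤ u i + J * u i * g s := add_le_add le_rfl h2
      _ = u i * Real.exp (J * s) := by
        rw [mul_comm J, mul_assoc, hgJ]; ring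
  have hle : ∀ i s, 0 ≤ s → variation ω i (Q s) ≤ w i s := by
    intro i s hs
    refine le_of_integral_inequality (Y := Y) (G := fun i j => 2 * ℒ.coupling i j)
      (D := fun i s => variation ω i (Q s)) (w := w) (w' := w') (M := 2 * ‖O‖)
      (fun i j => mul_nonneg zero_le_two (ℒ.coupling_nonneg i j)) hvar ?_ ?_ ?_ ?_ ?_ i hs
    · intro i s
      by_cases hi : i ∈ Y
      · simpa [hw, hw', hi] using hasDerivAt_const s (2 * ‖O‖)
      · simpa [hw, hw', hi] using (hg' s).const_mul (u i)
    · intro i s hs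
      simp only [hw]
      split_ifs
      · positivity
      · exact mul_nonneg (hu0 i) (hg0 s hs)
    · intro i hi s hs
      simpa [hw', hi] using hsuper i hi s hs
    · intro i hi s hs
      simpa [hw, hi] using hvar i s hs
    · intro i hi B B' hB hBB t ht
      have := ℒ.variation_semigroup_le ω T (hO i hi) (B := fun s => B s / 2)
        (fun s => (hB s).div_const 2) (fun s hs => ?_) ht
      · exact this.trans (le_of_eq (by ring))
      · rw [le_div_iff₀ two_pos, Finset.sum_mul]
        refine le_trans (le_of_eq (Finset.sum_congr rfl fun j _ => ?_)) (hBB s hs)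
        ring
  -- The dropped terms at `j` produce half the right-hand side of the variation inequality at `j`,
  -- so the barrier estimate bounds them too.
  have hB : ∀ s, HasDerivAt (fun s => (∑ j ∈ Wᶜ, u j) / 2 * g s)
      ((∑ j ∈ Wᶜ, u j) / 2 * Real.exp (J * s)) s := fun s => (hg' s).const_mul _
  have := norm_semigroup_sub_le (G := ℒ.adjointOn S) (H := ℒ.adjointOn T)
    (ℒ.isDissipative_adjointOn S) (x := O) hB ht fun s hs _ => ?_
  · refine this.trans (le_of_eq ?_)
    have e : (2 : ℝ) ^ (α + 2) = 2 * 2 ^ (α + 1) := by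
      rw [show α + 2 = 1 + (α + 1) by ring, Real.rpow_add two_pos, Real.rpow_one]
    simp only [hu, ← Finset.mul_sum, e, hF, hg]
    simp
    ring
  · refine (ℒ.norm_adjointOn_sub_apply_le ω S W fun x hx =>
      ℒ.semigroup_adjointOn_mem_trivialAt (fun hx' => hx (Finset.mem_inter.1 hx').2) s
        (hO x fun hx' => hx (hYW hx'))).trans ?_
    rw [div_mul_eq_mul_div, le_div_iff₀ two_pos, Finset.sum_mul, Finset.sum_mul]
    refine Finset.sum_le_sum fun j hj => ?_
    refine le_trans ?_ (hsuper j (fun hj' => Finset.mem_compl.1 hj (hYW hj')) s hs)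
    rw [Finset.sum_mul]
    refine Finset.sum_le_sum fun i _ => ?_
    have := mul_le_mul_of_nonneg_left (hle i s hs) (ℒ.coupling_nonneg j i)
    simp only [hQ] at this
    linarith

end Liouvillian

end Coupling

/-! ### Sums of powers by telescoping -/

section PowerSums

/-- A discrete form of comparison with the integral, from `log y ≥ 1 - 1/y` at `y = (x+1)/x`. -/
lemma rpow_neg_le_sub_div {s x : ℝ} (hs : 1 < s) (hx : 0 < x) :
    (x + 1) ^ (-s) ≤ (x ^ (1 - s) - (x + 1) ^ (1 - s)) / (s - 1) := by
  have h1 : 0 < s - 1 := sub_pos.2 hs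
  have hy : 0 < x + 1 := by linarith
  rw [le_div_iff₀ h1]
  have h2 : 1 + (s - 1) * (1 / (x + 1)) ≤ ((x + 1) / x) ^ (s - 1) := by
    rw [Real.rpow_def_of_pos (by positivity)]
    have h3 := Real.one_sub_inv_le_log_of_pos (show 0 < (x + 1) / x by positivity)
    have h4 : 1 - ((x + 1) / x)⁻¹ = 1 / (x + 1) := by field_simp; ring
    rw [h4] at h3
    refine le_trans ?_ (Real.add_one_le_exp _)
    nlinarith
  have e1 : ((x + 1) / x) ^ (s - 1) = x ^ (1 - s) * (x + 1) ^ (s - 1) := by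
    rw [Real.div_rpow hy.le hx.le, ← neg_sub s 1, Real.rpow_neg hx.le]
    field_simp
  have e2 : (x + 1) ^ (1 - s) * (x + 1) ^ (s - 1) = 1 := by
    rw [← Real.rpow_add hy]; simp
  have e3 : (x + 1) ^ (-s) = (x + 1) ^ (1 - s) * (1 / (x + 1)) := by
    rw [show -s = (1 - s) + (-1) by ring, Real.rpow_add hy, Real.rpow_neg_one, one_div]
  have h5 := mul_le_mul_of_nonneg_left h2 (by positivity : 0 ≤ (x + 1) ^ (1 - s))
  rw [e1, mul_left_comm, e2, mul_one] at h5
  rw [e3]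
  linarith

lemma rpow_neg_le_sub_div_of_lt_one {s x : ℝ} (hs0 : 0 < s) (hs : s < 1) (hx : 0 ≤ x) :
    (x + 1) ^ (-s) ≤ ((x + 1) ^ (1 - s) - x ^ (1 - s)) / (1 - s) := by
  have h1 : 0 < 1 - s := sub_pos.2 hs
  have hy : 0 < x + 1 := by linarith
  rw [le_div_iff₀ h1]
  have h2 := rpow_one_add_le_one_add_mul_self (s := -(1 / (x + 1)))
    (by rw [neg_le_neg_iff, div_le_one hy]; linarith) h1.le (by linarith : 1 - s ≤ 1)
  have e0 : 1 + -(1 / (x + 1)) = x / (x + 1) := by field_simp; ring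
  rw [e0, Real.div_rpow hx hy.le, div_le_iff₀ (by positivity)] at h2
  have e3 : (x + 1) ^ (-s) = (x + 1) ^ (1 - s) * (1 / (x + 1)) := by
    rw [show -s = (1 - s) + (-1) by ring, Real.rpow_add hy, Real.rpow_neg_one, one_div]
  rw [e3]
  linarith

lemma sum_add_rpow_neg_le {s m : ℝ} (hs : 1 < s) (hm : 0 < m) (N : ℕ) :
    ∑ n ∈ Finset.range N, (m + n + 1) ^ (-s) ≤ m ^ (1 - s) / (s - 1) := by
  have h : ∑ n ∈ Finset.range N, (m + n + 1) ^ (-s) ≤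
      (m ^ (1 - s) - (m + N) ^ (1 - s)) / (s - 1) := by
    induction N with
    | zero => simp
    | succ N ih =>
      rw [Finset.sum_range_succ]
      have := rpow_neg_le_sub_div hs (show 0 < m + N by positivity)
      push_cast
      rw [← add_assoc]
      calc _ ≤ _ := add_le_add ih this
        _ = _ := by ring
  refine h.trans ?_
  have : 0 < s - 1 := sub_pos.2 hs
  gcongr
  have : 0 ≤ (m + N) ^ (1 - s) := by positivity
  linarith

lemma sum_rpow_neg_le_of_lt_one {s : ℝ} (hs0 : 0 < s) (hs : s < 1) (N : ℕ) :
    ∑ n ∈ Finset.range N, ((n : ℝ) + 1) ^ (-s) ≤ (N : ℝ) ^ (1 - s) / (1 - s) := by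
  induction N with
  | zero => simp [Real.zero_rpow (sub_pos.2 hs).ne']
  | succ N ih =>
    rw [Finset.sum_range_succ]
    have := rpow_neg_le_sub_div_of_lt_one hs0 hs (Nat.cast_nonneg (α := ℝ) N)
    push_cast
    calc _ ≤ _ := add_le_add ih this
      _ = _ := by ring

end PowerSums

/-! ### Lattice sums of the decay function -/

section Lattice

variable {d : ℕ}

lemma card_le_of_siteDist_le (S : Finset (Fin d → ℤ)) (j : Fin d → ℤ) {R : ℝ} (hR : 0 ≤ R)
    (h : ∀ k ∈ S, siteDist k j ≤ R) : (S.card : ℝ) ≤ (2 * (1 + R)) ^ d := by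
  have hsub : S ⊆ Fintype.piFinset fun i => Finset.Icc (j i - ⌊R⌋) (j i + ⌊R⌋) := by
    intro k hk
    rw [Fintype.mem_piFinset]
    intro i
    have h1 := (abs_sub_le_siteDist k j i).trans (h k hk)
    have h2 : |k i - j i| ≤ ⌊R⌋ := by
      rw [Int.le_floor]
      exact_mod_cast h1
    rw [abs_le] at h2
    rw [Finset.mem_Icc]
    constructor <;> linarith
  have h1 := Finset.card_le_card hsub
  rw [Fintype.card_piFinset] at h1
  simp only [Int.card_Icc] at h1
  have hf : 0 ≤ ⌊R⌋ := Int.floor_nonneg.2 hR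
  calc (S.card : ℝ) ≤ ((∏ i : Fin d, (j i + ⌊R⌋ + 1 - (j i - ⌊R⌋)).toNat : ℕ) : ℝ) :=
        Nat.cast_le.2 h1
    _ = ∏ i : Fin d, (2 * (⌊R⌋ : ℝ) + 1) := by
        push_cast
        refine Finset.prod_congr rfl fun i _ => ?_
        rw [show j i + ⌊R⌋ + 1 - (j i - ⌊R⌋) = 2 * ⌊R⌋ + 1 by ring]
        have : (((2 * ⌊R⌋ + 1).toNat : ℤ) : ℝ) = ((2 * ⌊R⌋ + 1 : ℤ) : ℝ) := by
          rw [Int.toNat_of_nonneg (by linarith)]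
        push_cast at this
        exact this
    _ ≤ (2 * (1 + R)) ^ d := by
        rw [Finset.prod_const, Finset.card_univ, Fintype.card_fin]
        have hf' : (0 : ℝ) ≤ ⌊R⌋ := by exact_mod_cast hf
        gcongr
        linarith [Int.floor_le R]

/-- Order the sites by distance from `j`: counting in balls forces the `n`-th nearest to lie at
distance of order at least `n^{1/d}`. This reduces the lattice sums for `α > d`, `α < d` and `α = d`
to sums over integers. -/
lemma sum_decay_le_sum_range (hd : 0 < d) {α : ℝ} (hα : 0 < α) (S : Finset (Fin d → ℤ))
    (j : Fin d → ℤ) {ρ : ℝ} (hρ : 0 < ρ) (h : ∀ k ∈ S, ρ ≤ 1 + siteDist k j) :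
    ∑ k ∈ S, decay α k j ≤
      ∑ n ∈ Finset.range S.card, 2 ^ α * (max ((2 * ρ) ^ d) ((n : ℝ) + 1)) ^ (-(α / d)) := by
  classical
  have hd' : (0 : ℝ) < d := Nat.cast_pos.2 hd
  induction S using Finset.induction_on_max_value (fun k => siteDist k j) with
  | empty => simp
  | insert a S ha hmax ih =>
    rw [Finset.sum_insert ha, Finset.card_insert_of_notMem ha, Finset.sum_range_succ, add_comm]
    refine add_le_add (ih fun k hk => h k (Finset.mem_insert_of_mem hk)) ?_
    have h0 := siteDist_nonneg a j
    set x := 1 + siteDist a j with hx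
    have hx0 : 0 < x := by linarith
    have h1 : max ((2 * ρ) ^ d) ((S.card : ℝ) + 1) ≤ (2 * x) ^ d := by
      refine max_le ?_ ?_
      · have := h a (Finset.mem_insert_self _ _)
        gcongr
      · have := card_le_of_siteDist_le (insert a S) j h0 fun k hk => by
          rcases Finset.mem_insert.1 hk with rfl | hk
          · exact le_rfl
          · exact hmax k hk
        rw [Finset.card_insert_of_notMem ha] at this
        exact_mod_cast this
    have h2 : ((2 * x) ^ d) ^ (-(α / d)) ≤ (max ((2 * ρ) ^ d) ((S.card : ℝ) + 1)) ^ (-(α / d)) :=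
      Real.rpow_le_rpow_of_nonpos (lt_max_of_lt_right (by positivity)) h1
        (neg_nonpos.2 (by positivity))
    rw [← Real.rpow_natCast, ← Real.rpow_mul (by positivity),
      show (d : ℝ) * -(α / d) = -α by field_simp, Real.mul_rpow two_pos.le hx0.le,
      Real.rpow_neg two_pos.le] at h2
    have h3 : (0 : ℝ) < 2 ^ α := by positivity
    calc decay α a j = 2 ^ α * ((2 ^ α)⁻¹ * x ^ (-α)) := by
          rw [decay, ← hx]; field_simp
      _ ≤ _ := mul_le_mul_of_nonneg_left (by exact_mod_cast h2) h3.le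

/-- Tail sums of the decay function for `α > d`. -/
lemma exists_sum_decay_le (hd : 0 < d) {α : ℝ} (hα : (d : ℝ) < α) :
    ∃ C : ℝ, 0 < C ∧ ∀ (S : Finset (Fin d → ℤ)) (j : Fin d → ℤ) (ρ : ℝ), 0 < ρ →
      (∀ k ∈ S, ρ ≤ 1 + siteDist k j) → ∑ k ∈ S, decay α k j ≤ C * ρ ^ ((d : ℝ) - α) := by
  have hd' : (0 : ℝ) < d := Nat.cast_pos.2 hd
  have hα0 : 0 < α := hd'.trans hα
  set s := α / d with hs
  have hs1 : 1 < s := (one_lt_div hd').2 hα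
  have hs1' : 0 < s - 1 := sub_pos.2 hs1
  refine ⟨2 ^ α * 2 ^ s * (2 ^ ((d : ℝ) - α) / (s - 1)), by positivity, fun S j ρ hρ h => ?_⟩
  refine (sum_decay_le_sum_range hd hα0 S j hρ h).trans ?_
  set m := (2 * ρ) ^ d with hm
  have hm0 : 0 < m := by positivity
  have h1 : ∀ n ∈ Finset.range S.card, 2 ^ α * (max m ((n : ℝ) + 1)) ^ (-s) ≤
      2 ^ α * 2 ^ s * (m + n + 1) ^ (-s) := by
    intro n _
    rw [mul_assoc]
    refine mul_le_mul_of_nonneg_left ?_ (by positivity)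
    have h2 : (m + n + 1) / 2 ≤ max m ((n : ℝ) + 1) := by
      have := le_max_left m ((n : ℝ) + 1)
      have := le_max_right m ((n : ℝ) + 1)
      linarith
    have h3 := Real.rpow_le_rpow_of_nonpos (by positivity) h2 (show -s ≤ 0 by linarith)
    rwa [Real.div_rpow (by positivity) two_pos.le, Real.rpow_neg two_pos.le, div_inv_eq_mul,
      mul_comm] at h3
  refine (Finset.sum_le_sum h1).trans ?_
  rw [← Finset.mul_sum]
  have h4 := sum_add_rpow_neg_le hs1 hm0 S.card
  have h5 : m ^ (1 - s) = 2 ^ ((d : ℝ) - α) * ρ ^ ((d : ℝ) - α) := by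
    rw [hm, ← Real.rpow_natCast, ← Real.rpow_mul (by positivity),
      show (d : ℝ) * (1 - s) = d - α by rw [hs]; field_simp, Real.mul_rpow two_pos.le hρ.le]
  rw [h5] at h4
  calc _ ≤ 2 ^ α * 2 ^ s * (2 ^ ((d : ℝ) - α) * ρ ^ ((d : ℝ) - α) / (s - 1)) :=
        mul_le_mul_of_nonneg_left h4 (by positivity)
    _ = _ := by ring

lemma sum_decay_le_of_lt (hd : 0 < d) {α : ℝ} (hα0 : 0 < α) (hα : α < d)
    (S : Finset (Fin d → ℤ)) (j : Fin d → ℤ) :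
    ∑ k ∈ S, decay α k j ≤ 2 ^ α / (1 - α / d) * (S.card : ℝ) ^ (1 - α / d) := by
  have hd' : (0 : ℝ) < d := Nat.cast_pos.2 hd
  refine (sum_decay_le_sum_range hd hα0 S j one_pos fun k _ => ?_).trans ?_
  · linarith [siteDist_nonneg k j]
  · rw [← Finset.mul_sum, div_mul_eq_mul_div, mul_div_assoc]
    refine mul_le_mul_of_nonneg_left (le_trans (Finset.sum_le_sum fun n _ => ?_)
      (sum_rpow_neg_le_of_lt_one (by positivity) ((div_lt_one hd').2 hα) _)) (by positivity)
    exact Real.rpow_le_rpow_of_nonpos (by positivity) (le_max_right _ _)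
      (neg_nonpos.2 (by positivity))

lemma sum_decay_le_log (hd : 0 < d) (S : Finset (Fin d → ℤ)) (j : Fin d → ℤ) :
    ∑ k ∈ S, decay d k j ≤ 2 ^ (d : ℝ) * (1 + Real.log S.card) := by
  have hd' : (0 : ℝ) < d := Nat.cast_pos.2 hd
  refine (sum_decay_le_sum_range hd hd' S j one_pos fun k _ => ?_).trans ?_
  · linarith [siteDist_nonneg k j]
  · rw [← Finset.mul_sum]
    have hh : (harmonic S.card : ℝ) = ∑ n ∈ Finset.range S.card, ((n : ℝ) + 1)⁻¹ := by
      simp [harmonic]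
    refine mul_le_mul_of_nonneg_left (le_trans (Finset.sum_le_sum fun n _ => ?_)
      (hh ▸ harmonic_le_one_add_log S.card)) (by positivity)
    rw [div_self hd'.ne', Real.rpow_neg_one]
    exact inv_anti₀ (by positivity) (le_max_right _ _)

end Lattice

/-! ### Truncation to a ball -/

section Regions

variable {d : ℕ} {Λ : Finset (Fin d → ℤ)} {q : Λ → ℕ}

lemma sum_coe_eq_sum_map (T : Finset Λ) (f : (Fin d → ℤ) → ℝ) :
    ∑ j ∈ T, f j.1 = ∑ k ∈ T.map (Function.Embedding.subtype _), f k := by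
  rw [Finset.sum_map]; rfl

lemma mem_ball {X i : Λ} {r : ℝ} : i ∈ ball X r ↔ siteDist i.1 X.1 ≤ r := by
  classical
  simp [ball]

lemma notMem_ball {X i : Λ} {r : ℝ} : i ∉ ball X r ↔ r < siteDist i.1 X.1 := by
  rw [mem_ball, not_le]

lemma ball_subset_ball {X : Λ} {r s : ℝ} (h : r ≤ s) : ball X r ⊆ ball X s :=
  fun _ hi => mem_ball.2 ((mem_ball.1 hi).trans h)

lemma Liouvillian.adjoint_eq_adjointOn_univ (ℒ : Liouvillian Λ q) :
    ℒ.adjoint = ℒ.adjointOn Finset.univ := by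
  rw [Liouvillian.adjoint, Liouvillian.adjointOn, Finset.powerset_univ]

lemma truncationError_eq (ℒ : Liouvillian Λ q) (X : Λ) (r t : ℝ) (A : Op Λ q) :
    truncationError ℒ X r t A = ‖semigroup (ℒ.adjointOn Finset.univ) t A -
      semigroup (ℒ.adjointOn (Finset.univ ∩ ball X r)) t A‖ := by
  rw [truncationError, ℒ.adjoint_eq_adjointOn_univ, Finset.univ_inter]
  rfl

lemma truncationError_le_two_mul (ℒ : Liouvillian Λ q) (X : Λ) (r : ℝ) {t : ℝ} (ht : 0 ≤ t)
    (A : Op Λ q) : truncationError ℒ X r t A ≤ 2 * ‖A‖ := by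
  rw [truncationError_eq, two_mul]
  exact (norm_sub_le _ _).trans (add_le_add
    ((ℒ.isDissipative_adjointOn _).norm_semigroup_apply_le ht A)
    ((ℒ.isDissipative_adjointOn _).norm_semigroup_apply_le ht A))

lemma truncationError_le {α : ℝ} (hα : 0 < α) {ℒ : Liouvillian Λ q} (h : ℒ.IsLongRange α)
    {Γ : ℝ} (hΓ0 : 0 < Γ) (hΓ : ∀ i : Λ, ∑ j : Λ, decay α i.1 j.1 ≤ Γ) {X : Λ} {A : Op Λ q}
    (hA : SupportedOn {X} A) {r t : ℝ} (hr : 0 ≤ r) (ht : 0 ≤ t) :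
    truncationError ℒ X r t A ≤ 2 ^ (α + 1) * ‖A‖ *
      ((Real.exp (growthRate α * Γ * t) - 1) / (growthRate α * Γ)) *
        ∑ j ∈ (ball X r)ᶜ, decay α j.1 X.1 := by
  classical
  rw [truncationError_eq]
  have hX : {X} ⊆ ball X r := by simpa [mem_ball] using hr
  simpa using Liouvillian.norm_semigroup_adjointOn_sub_le h hα hΓ0 hΓ Finset.univ hX
    (fun x hx => hA.mem_trivialAt hx) ht

lemma sum_decay_row (α : ℝ) (i : Λ) :
    ∑ j : Λ, decay α i.1 j.1 = ∑ k ∈ Λ, decay α k i.1 := by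
  simp only [decay_comm α i.1]
  exact Finset.sum_coe_sort Λ fun k => decay α k i.1

lemma exists_row_bound (hd : 0 < d) {α : ℝ} (hα : (d : ℝ) < α) :
    ∃ Γ : ℝ, 0 < Γ ∧ ∀ (Λ : Finset (Fin d → ℤ)) (i : Λ), ∑ j : Λ, decay α i.1 j.1 ≤ Γ := by
  obtain ⟨C, hC, h⟩ := exists_sum_decay_le hd hα
  refine ⟨C, hC, fun Λ i => ?_⟩
  rw [sum_decay_row]
  simpa using h Λ i.1 1 one_pos fun k _ => by linarith [siteDist_nonneg k i.1]

end Regions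

/-! ### The bounds with exponentials -/

section Bounds

variable {d : ℕ} {α : ℝ}

theorem exists_truncationError_le_exp (hd : 0 < d) (hα : 0 < α) (hdα : (d : ℝ) < α) :
    ∃ K v : ℝ, 0 < K ∧ 0 < v ∧
      ∀ (Λ : Finset (Fin d → ℤ)) (q : Λ → ℕ) (ℒ : Liouvillian Λ q), ℒ.IsLongRange α →
      ∀ (X : Λ) (A : Op Λ q), SupportedOn {X} A → ∀ r t : ℝ, 0 < r → 0 ≤ t →
        truncationError ℒ X r t A ≤ K * ‖A‖ * (Real.exp (v * t) / r ^ (α - d)) := by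
  obtain ⟨Γ, hΓ0, hΓ⟩ := exists_row_bound hd hdα
  obtain ⟨C, hC, hsum⟩ := exists_sum_decay_le hd hdα
  have hv : 0 < growthRate α * Γ := mul_pos (growthRate_pos α) hΓ0
  refine ⟨2 ^ (α + 1) * C / (growthRate α * Γ), growthRate α * Γ, by positivity, hv, ?_⟩
  intro Λ q ℒ h X A hA r t hr ht
  refine (truncationError_le hα h hΓ0 (hΓ Λ) hA hr.le ht).trans ?_
  have h1 : ∑ j ∈ (ball X r)ᶜ, decay α j.1 X.1 ≤ C * r ^ ((d : ℝ) - α) := by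
    rw [sum_coe_eq_sum_map _ fun k => decay α k X.1]
    refine hsum _ _ r hr fun k hk => ?_
    obtain ⟨j, hj, rfl⟩ := Finset.mem_map.1 hk
    have := notMem_ball.1 (Finset.mem_compl.1 hj)
    simp only [Function.Embedding.subtype_apply]
    linarith
  rw [← neg_sub α, Real.rpow_neg hr.le] at h1
  set v := growthRate α * Γ
  calc _ ≤ 2 ^ (α + 1) * ‖A‖ * (Real.exp (v * t) / v) * (C * (r ^ (α - d))⁻¹) := by
        refine mul_le_mul ?_ h1 (Finset.sum_nonneg fun _ _ => (decay_pos _ _ _).le)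
          (by positivity)
        gcongr
        linarith
    _ = _ := by ring

theorem exists_truncationError_le_of_lt (hd : 0 < d) (hα : 0 < α) (hdα : α < d) :
    ∃ c : ℝ, 0 < c ∧ ∀ κ : ℝ, 0 < κ →
      (∃ K : ℝ, 0 < K ∧
        ∀ (Λ : Finset (Fin d → ℤ)) (q : Λ → ℕ) (ℒ : Liouvillian Λ q), ℒ.IsLongRange α →
        ∀ (X : Λ) (A : Op Λ q), SupportedOn {X} A →
        ∀ r t : ℝ, κ * (Λ.card : ℝ) ^ (1 / (d : ℝ)) ≤ r → 0 ≤ t →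
          truncationError ℒ X r t A ≤
            K * ‖A‖ * (Real.exp (c * (Λ.card : ℝ) ^ (1 - α / d) * t) - 1)) ∧
      (∀ t₀ : ℝ, 0 < t₀ → ∃ K : ℝ, 0 < K ∧
        ∀ (Λ : Finset (Fin d → ℤ)) (q : Λ → ℕ) (ℒ : Liouvillian Λ q), ℒ.IsLongRange α →
        ∀ (X : Λ) (A : Op Λ q), SupportedOn {X} A →
        ∀ r t : ℝ, κ * (Λ.card : ℝ) ^ (1 / (d : ℝ)) ≤ r → t₀ ≤ t →
          truncationError ℒ X r t A ≤
            K * ‖A‖ * ((Real.exp (c * (Λ.card : ℝ) ^ (1 - α / d) * t) - 1) /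
              (c * (Λ.card : ℝ) ^ (1 - α / d)))) := by
  have hd' : (0 : ℝ) < d := Nat.cast_pos.2 hd
  set C : ℝ := 2 ^ α / (1 - α / d) with hC
  have hC0 : 0 < C := div_pos (by positivity) (sub_pos.2 ((div_lt_one hd').2 hdα))
  have hg := growthRate_pos α
  refine ⟨growthRate α * C, by positivity, fun κ hκ => ⟨⟨2 ^ (α + 1) / growthRate α,
    by positivity, ?_⟩, fun t₀ ht₀ => ⟨2 / t₀, by positivity, ?_⟩⟩⟩
  · intro Λ q ℒ h X A hA r t hr ht
    have hN : (0 : ℝ) < Λ.card := Nat.cast_pos.2 (Finset.card_pos.2 ⟨X.1, X.2⟩)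
    set n := (Λ.card : ℝ) ^ (1 - α / d) with hn
    have hn0 : 0 < n := by positivity
    have hΓ : ∀ i : Λ, ∑ j : Λ, decay α i.1 j.1 ≤ C * n := fun i => by
      rw [sum_decay_row]
      exact sum_decay_le_of_lt hd hα hdα Λ i.1
    refine (truncationError_le hα h (by positivity) hΓ hA
      (le_trans (by positivity) hr) ht).trans ?_
    -- The sum outside the ball is bounded by the full row sum, which cancels the denominator `J` up
    -- to a constant.
    have h1 : ∑ j ∈ (ball X r)ᶜ, decay α j.1 X.1 ≤ C * n := by
      refine le_trans ?_ (hΓ X)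
      simp only [decay_comm α X.1]
      exact Finset.sum_le_sum_of_subset_of_nonneg (Finset.subset_univ _)
        fun _ _ _ => (decay_pos _ _ _).le
    have h2 : 0 ≤ Real.exp (growthRate α * (C * n) * t) - 1 :=
      sub_nonneg.2 (Real.one_le_exp (by positivity))
    calc _ ≤ 2 ^ (α + 1) * ‖A‖ * ((Real.exp (growthRate α * (C * n) * t) - 1) /
          (growthRate α * (C * n))) * (C * n) := by gcongr
      _ = _ := by rw [← mul_assoc (growthRate α)]; field_simp
  · intro Λ q ℒ h X A hA r t hr ht
    have hN : (0 : ℝ) < Λ.card := Nat.cast_pos.2 (Finset.card_pos.2 ⟨X.1, X.2⟩)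
    set J := growthRate α * C * (Λ.card : ℝ) ^ (1 - α / d) with hJ
    have hJ0 : 0 < J := by positivity
    refine (truncationError_le_two_mul ℒ X r (ht₀.le.trans ht) A).trans ?_
    -- The quotient is at least `t`, so for times bounded below the contraction bound `2‖A‖` already
    -- suffices.
    have h1 : t₀ ≤ (Real.exp (J * t) - 1) / J := by
      rw [le_div_iff₀ hJ0]
      nlinarith [Real.add_one_le_exp (J * t)]
    calc 2 * ‖A‖ = 2 / t₀ * ‖A‖ * t₀ := by field_simp
      _ ≤ _ := by gcongr

theorem exists_truncationError_le_log (hd : 0 < d) (hdα : α = d) :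
    ∃ c : ℝ, 0 < c ∧ ∀ κ : ℝ, 0 < κ → ∃ K : ℝ, 0 < K ∧
      ∀ (Λ : Finset (Fin d → ℤ)) (q : Λ → ℕ) (ℒ : Liouvillian Λ q), ℒ.IsLongRange α →
      2 ≤ Λ.card →
      ∀ (X : Λ) (A : Op Λ q), SupportedOn {X} A →
      ∀ r t : ℝ, κ * (Λ.card : ℝ) ^ (1 / (d : ℝ)) ≤ r → 0 ≤ t →
        truncationError ℒ X r t A ≤
          K * ‖A‖ * ((Real.exp (c * Real.log Λ.card * t) - 1) / (c * Real.log Λ.card)) := by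
  subst hdα
  have hd' : (0 : ℝ) < d := Nat.cast_pos.2 hd
  have hl2 : 0 < Real.log 2 := Real.log_pos one_lt_two
  set C : ℝ := 2 ^ (d : ℝ) * (1 / Real.log 2 + 1) with hC
  have hC0 : 0 < C := by positivity
  have hg := growthRate_pos d
  refine ⟨growthRate d * C, by positivity, fun κ hκ => ⟨2 ^ ((d : ℝ) + 1) * κ ^ (-(d : ℝ)),
    by positivity, ?_⟩⟩
  intro Λ q ℒ h hcard X A hA r t hr ht
  have hN2 : (2 : ℝ) ≤ Λ.card := by exact_mod_cast hcard
  have hN : (0 : ℝ) < Λ.card := by linarith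
  have hlog : Real.log 2 ≤ Real.log Λ.card := Real.log_le_log two_pos hN2
  have hlog0 : 0 < Real.log Λ.card := hl2.trans_le hlog
  have hΓ : ∀ i : Λ, ∑ j : Λ, decay d i.1 j.1 ≤ C * Real.log Λ.card := fun i => by
    rw [sum_decay_row]
    refine (sum_decay_le_log hd Λ i.1).trans ?_
    rw [hC, mul_assoc]
    refine mul_le_mul_of_nonneg_left ?_ (by positivity)
    -- `N ≥ 2` lets the additive 1 of the harmonic sum be absorbed into `log N`.
    have : 1 ≤ 1 / Real.log 2 * Real.log Λ.card := by
      rw [one_div_mul_eq_div, one_le_div hl2]; exact hlog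
    linarith
  have hr0 : 0 < r := lt_of_lt_of_le (by positivity) hr
  refine (truncationError_le hd' h (by positivity) hΓ hA hr0.le ht).trans ?_
  have h1 : ∑ j ∈ (ball X r)ᶜ, decay d j.1 X.1 ≤ κ ^ (-(d : ℝ)) := by
    -- At distance at least `κ N^{1/d}` the decay is of order `1 / N`, so the at most `N` outer
    -- sites contribute a constant.
    have h2 : ∀ j ∈ (ball X r)ᶜ, decay d j.1 X.1 ≤ κ ^ (-(d : ℝ)) * (Λ.card : ℝ)⁻¹ := by
      intro j hj
      have h3 := notMem_ball.1 (Finset.mem_compl.1 hj)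
      have h4 : (κ * (Λ.card : ℝ) ^ (1 / (d : ℝ))) ^ (-(d : ℝ)) =
          κ ^ (-(d : ℝ)) * (Λ.card : ℝ)⁻¹ := by
        rw [Real.mul_rpow hκ.le (by positivity), ← Real.rpow_mul hN.le,
          show 1 / (d : ℝ) * -(d : ℝ) = -1 by field_simp, Real.rpow_neg_one]
      rw [← h4]
      exact Real.rpow_le_rpow_of_nonpos (by positivity) (by linarith) (by linarith)
    refine (Finset.sum_le_card_nsmul _ _ _ h2).trans ?_
    have h5 : (((ball X r)ᶜ.card : ℕ) : ℝ) ≤ Λ.card := by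
      have := Finset.card_le_univ (ball X r)ᶜ
      rw [Fintype.card_coe] at this
      exact_mod_cast this
    rw [nsmul_eq_mul]
    calc _ ≤ (Λ.card : ℝ) * (κ ^ (-(d : ℝ)) * (Λ.card : ℝ)⁻¹) := by gcongr
      _ = κ ^ (-(d : ℝ)) := by field_simp
  have h2 : 0 ≤ Real.exp (growthRate d * (C * Real.log Λ.card) * t) - 1 :=
    sub_nonneg.2 (Real.one_le_exp (by positivity))
  calc _ ≤ 2 ^ ((d : ℝ) + 1) * ‖A‖ * ((Real.exp (growthRate d * (C * Real.log Λ.card) * t) - 1) /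
        (growthRate d * (C * Real.log Λ.card))) * κ ^ (-(d : ℝ)) := by gcongr
    _ = _ := by rw [← mul_assoc (growthRate d)]; ring

end Bounds

/-! ### Time slicing for `α > 3d` -/

section Slices

variable {d : ℕ} {α : ℝ}

/-- Error of restricting the dynamics to a region, for times up to `1` and `α > d`. -/
lemma exists_norm_semigroup_sub_le_of_le_one (hd : 0 < d) (hα : 0 < α) (hdα : (d : ℝ) < α) :
    ∃ C : ℝ, 0 < C ∧ ∀ (Λ : Finset (Fin d → ℤ)) (q : Λ → ℕ) (ℒ : Liouvillian Λ q),
      ℒ.IsLongRange α → ∀ (S W Y : Finset Λ), Y ⊆ W → ∀ O : Op Λ q,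
      (∀ x, x ∉ Y → O ∈ trivialAt x) → ∀ t : ℝ, 0 ≤ t → t ≤ 1 →
      ‖semigroup (ℒ.adjointOn S) t O - semigroup (ℒ.adjointOn (S ∩ W)) t O‖ ≤
        C * ‖O‖ * ∑ j ∈ Wᶜ, ∑ k ∈ Y, decay α j.1 k.1 := by
  obtain ⟨Γ, hΓ0, hΓ⟩ := exists_row_bound hd hdα
  set v := growthRate α * Γ with hv
  have hv0 : 0 < v := mul_pos (growthRate_pos α) hΓ0
  refine ⟨2 ^ (α + 1) * (Real.exp v / v), by positivity, fun Λ q ℒ h S W Y hYW O hO t ht ht1 => ?_⟩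
  refine (Liouvillian.norm_semigroup_adjointOn_sub_le h hα hΓ0 (hΓ Λ) S hYW hO ht).trans ?_
  refine mul_le_mul_of_nonneg_right ?_ (Finset.sum_nonneg fun _ _ =>
    Finset.sum_nonneg fun _ _ => (decay_pos _ _ _).le)
  rw [mul_right_comm]
  gcongr
  have : Real.exp (v * t) ≤ Real.exp v := Real.exp_le_exp.2 (mul_le_of_le_one_right hv0.le ht1)
  linarith

lemma exists_sum_ball_decay_le (hd : 0 < d) (hdα : (d : ℝ) < α) :
    ∃ C : ℝ, 0 < C ∧ ∀ (Λ : Finset (Fin d → ℤ)) (X : Λ) (p x : ℝ), 0 ≤ p → 0 < x →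
      ∑ j ∈ (ball X (p + x))ᶜ, ∑ k ∈ ball X p, decay α j.1 k.1 ≤
        C * (2 * (1 + p)) ^ d * x ^ ((d : ℝ) - α) := by
  obtain ⟨C, hC, h⟩ := exists_sum_decay_le hd hdα
  refine ⟨C, hC, fun Λ X p x hp hx => ?_⟩
  rw [Finset.sum_comm]
  have h1 : ∀ k ∈ ball X p, ∑ j ∈ (ball X (p + x))ᶜ, decay α j.1 k.1 ≤
      C * x ^ ((d : ℝ) - α) := by
    intro k hk
    rw [sum_coe_eq_sum_map _ fun j => decay α j k.1]
    refine h _ _ x hx fun j hj => ?_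
    obtain ⟨i, hi, rfl⟩ := Finset.mem_map.1 hj
    have h1 := notMem_ball.1 (Finset.mem_compl.1 hi)
    have h2 := mem_ball.1 hk
    have h3 := siteDist_triangle i.1 k.1 X.1
    simp only [Function.Embedding.subtype_apply]
    linarith
  refine (Finset.sum_le_card_nsmul _ _ _ h1).trans ?_
  have h2 : ((ball X p).card : ℝ) ≤ (2 * (1 + p)) ^ d := by
    have := card_le_of_siteDist_le ((ball X p).map (Function.Embedding.subtype _)) X.1 hp
      fun k hk => by
        obtain ⟨j, hj, rfl⟩ := Finset.mem_map.1 hk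
        exact mem_ball.1 hj
    rwa [Finset.card_map] at this
  rw [nsmul_eq_mul]
  calc _ ≤ (2 * (1 + p)) ^ d * (C * x ^ ((d : ℝ) - α)) := by gcongr
    _ = _ := by ring

/-- Composition of time slices, in each of which the support is allowed to grow by `l`. -/
lemma exists_approx_of_slices {Λ : Finset (Fin d → ℤ)} {q : Λ → ℕ} (ℒ : Liouvillian Λ q) {X : Λ}
    {A : Op Λ q} (hA : SupportedOn {X} A) {τ l ε : ℝ} (hτ : 0 ≤ τ) {M : ℕ}
    (hε : ∀ m : ℕ, m < M → ∀ (S : Finset Λ) (O : Op Λ q),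
      (∀ x, x ∉ ball X (m * l) → O ∈ trivialAt x) →
      ‖semigroup (ℒ.adjointOn S) τ O -
        semigroup (ℒ.adjointOn (S ∩ ball X (m * l + l))) τ O‖ ≤ ε * ‖O‖) (hl : 0 ≤ l)
    (hε0 : 0 ≤ ε) (m : ℕ) (hm : m ≤ M) :
    ∃ Q : Op Λ q, (∀ x, x ∉ ball X (m * l) → Q ∈ trivialAt x) ∧ ‖Q‖ ≤ ‖A‖ ∧
      ∀ S : Finset Λ, ball X (M * l) ⊆ S →
        ‖semigroup (ℒ.adjointOn S) (m * τ) A - Q‖ ≤ m * ε * ‖A‖ := by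
  induction m with
  | zero =>
    refine ⟨A, fun x hx => hA.mem_trivialAt fun hx' => hx ?_, le_rfl, fun S _ => by simp⟩
    rw [Finset.mem_singleton] at hx'
    simp [mem_ball, hx']
  | succ m ih =>
    obtain ⟨Q, hQ, hQA, hS⟩ := ih (by omega)
    have e1 : ((m + 1 : ℕ) : ℝ) * l = m * l + l := by push_cast; ring
    have hML : (m : ℝ) * l + l ≤ M * l := by
      rw [← e1]
      exact mul_le_mul_of_nonneg_right (Nat.cast_le.2 hm) hl
    refine ⟨semigroup (ℒ.adjointOn (ball X (m * l + l))) τ Q, fun x hx => ?_, ?_, fun S hMS => ?_⟩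
    · rw [e1] at hx
      exact ℒ.semigroup_adjointOn_mem_trivialAt hx τ
        (hQ x fun hx' => hx (ball_subset_ball (by linarith) hx'))
    · exact ((ℒ.isDissipative_adjointOn _).norm_semigroup_apply_le hτ Q).trans hQA
    · have e2 : ((m + 1 : ℕ) : ℝ) * τ = τ + m * τ := by push_cast; ring
      -- The approximating evolution therefore does not depend on `S`, so one `Q` serves both the
      -- full and the truncated dynamics.
      have e3 : S ∩ ball X (m * l + l) = ball X (m * l + l) :=
        Finset.inter_eq_right.2 ((ball_subset_ball hML).trans hMS)
      have h1 := hε m (by omega) S Q hQ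
      rw [e3] at h1
      rw [e2, semigroup_add_apply]
      set P := semigroup (ℒ.adjointOn S) (m * τ) A
      have e4 : semigroup (ℒ.adjointOn S) τ P - semigroup (ℒ.adjointOn (ball X (m * l + l))) τ Q =
          semigroup (ℒ.adjointOn S) τ (P - Q) + (semigroup (ℒ.adjointOn S) τ Q -
            semigroup (ℒ.adjointOn (ball X (m * l + l))) τ Q) := by
        rw [map_sub]; abel
      rw [e4]
      refine (norm_add_le _ _).trans ?_
      have h2 := ((ℒ.isDissipative_adjointOn S).norm_semigroup_apply_le hτ (P - Q)).trans (hS S hMS)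
      have h3 : ε * ‖Q‖ ≤ ε * ‖A‖ := mul_le_mul_of_nonneg_left hQA hε0
      push_cast
      linarith

/-- With `⌈t⌉` slices the errors sum to order `⌈t⌉^p r^{2d-α}`, where `p = α - d + 1`. The further
factor `r^d` allowed by the claim is spent on replacing `⌈t⌉` by `t` at small times. -/
theorem exists_truncationError_le_pow (hd : 0 < d) (hα : 0 < α) (hdα : 3 * (d : ℝ) < α) :
    ∃ K : ℝ, 0 < K ∧ ∀ t₀ : ℝ, 0 < t₀ → ∃ r₀ : ℝ, 0 < r₀ ∧
      ∀ (Λ : Finset (Fin d → ℤ)) (q : Λ → ℕ) (ℒ : Liouvillian Λ q), ℒ.IsLongRange α →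
      ∀ (X : Λ) (A : Op Λ q), SupportedOn {X} A → ∀ r t : ℝ, r₀ ≤ r → t₀ ≤ t →
        truncationError ℒ X r t A ≤ K * ‖A‖ * (t ^ (α - d + 1) / r ^ (α - 3 * d)) := by
  have hd' : (0 : ℝ) < d := Nat.cast_pos.2 hd
  have hdα' : (d : ℝ) < α := by linarith
  obtain ⟨C₁, hC₁, h₁⟩ := exists_norm_semigroup_sub_le_of_le_one hd hα hdα'
  obtain ⟨C₂, hC₂, h₂⟩ := exists_sum_ball_decay_le hd hdα'
  set p := α - d + 1 with hp
  have hp0 : 0 < p := by linarith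
  refine ⟨2 * C₁ * C₂ * 4 ^ d * 2 ^ p * 2, by positivity, fun t₀ ht₀ =>
    ⟨1 + t₀ ^ (-p), by positivity, ?_⟩⟩
  intro Λ q ℒ h X A hA r t hr ht
  have ht0 : 0 < t := ht₀.trans_le ht
  have htp : 0 < t₀ ^ (-p) := by positivity
  have hr1 : 1 ≤ r := by linarith
  have hr0 : 0 < r := by linarith
  set M := ⌈t⌉₊ with hM
  have hM0 : 0 < M := Nat.ceil_pos.2 ht0
  have hM0' : (0 : ℝ) < M := Nat.cast_pos.2 hM0
  have htM : t ≤ M := Nat.le_ceil t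
  set l := r / M with hl
  have hl0 : 0 < l := by positivity
  have hMl : M * l = r := mul_div_cancel₀ _ hM0'.ne'
  set ε := C₁ * (C₂ * (2 * (1 + r)) ^ d * l ^ ((d : ℝ) - α)) with hε
  have hε0 : 0 ≤ ε := by positivity
  have hslice : ∀ m : ℕ, m < M → ∀ (S : Finset Λ) (O : Op Λ q),
      (∀ x, x ∉ ball X (m * l) → O ∈ trivialAt x) →
      ‖semigroup (ℒ.adjointOn S) (t / M) O -
        semigroup (ℒ.adjointOn (S ∩ ball X (m * l + l))) (t / M) O‖ ≤ ε * ‖O‖ := by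
    intro m hm S O hO
    have hml : m * l ≤ r := by
      rw [← hMl]
      exact mul_le_mul_of_nonneg_right (Nat.cast_le.2 hm.le) hl0.le
    refine (h₁ Λ q ℒ h S _ _ (ball_subset_ball (by linarith)) O hO (t / M) (by positivity)
      ((div_le_one hM0').2 htM)).trans ?_
    have := (h₂ Λ X (m * l) l (by positivity) hl0).trans (show _ ≤
      C₂ * (2 * (1 + r)) ^ d * l ^ ((d : ℝ) - α) by gcongr)
    calc _ ≤ C₁ * ‖O‖ * (C₂ * (2 * (1 + r)) ^ d * l ^ ((d : ℝ) - α)) := by gcongr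
      _ = _ := by rw [hε]; ring
  obtain ⟨Q, -, -, hQ⟩ := exists_approx_of_slices ℒ hA (by positivity) hslice hl0.le hε0 M le_rfl
  have e1 : M * (t / M) = t := mul_div_cancel₀ _ hM0'.ne'
  rw [e1, hMl] at hQ
  have hQ1 := hQ Finset.univ (Finset.subset_univ _)
  have hQ2 := hQ (Finset.univ ∩ ball X r) (by rw [Finset.univ_inter])
  have hmain : truncationError ℒ X r t A ≤ 2 * (M * ε * ‖A‖) := by
    rw [truncationError_eq, two_mul, ← sub_sub_sub_cancel_right _ _ Q]
    exact (norm_sub_le _ _).trans (add_le_add hQ1 hQ2)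
  refine hmain.trans ?_
  have hrd : 1 ≤ r ^ d := one_le_pow₀ hr1
  have hr2d : (2 * (1 + r)) ^ d ≤ 4 ^ d * r ^ d := by
    rw [← mul_pow]
    exact pow_le_pow_left₀ (by positivity) (by linarith) d
  have hlpow : M * l ^ ((d : ℝ) - α) = (M : ℝ) ^ p * r ^ ((d : ℝ) - α) := by
    rw [hl, Real.div_rpow hr0.le hM0'.le, hp, Real.rpow_add_one hM0'.ne',
      show (d : ℝ) - α = -(α - d) by ring, Real.rpow_neg hM0'.le]
    field_simp
  have hMp : (M : ℝ) ^ p ≤ 2 ^ p * (t ^ p + 1) := by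
    have hMt : (M : ℝ) ≤ t + 1 := (Nat.ceil_lt_add_one ht0.le).le
    have : (M : ℝ) ^ p ≤ (2 * max t 1) ^ p := by
      refine Real.rpow_le_rpow hM0'.le (hMt.trans ?_) hp0.le
      have := le_max_left t 1
      have := le_max_right t 1
      linarith
    rw [Real.mul_rpow two_pos.le (by positivity)] at this
    refine this.trans (mul_le_mul_of_nonneg_left ?_ (by positivity))
    rcases le_total t 1 with ht1 | ht1
    · rw [max_eq_right ht1, Real.one_rpow]
      linarith [Real.rpow_nonneg ht0.le p]
    · rw [max_eq_left ht1]
      linarith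
  -- This is where `r₀ ≥ t₀^{-p}` enters; it keeps `K` independent of `t₀`.
  have htr : t ^ p + 1 ≤ 2 * (t ^ p * r ^ d) := by
    have h1 : 1 ≤ t ^ p * r ^ d := by
      have h2 : t₀ ^ p ≤ t ^ p := Real.rpow_le_rpow ht₀.le ht hp0.le
      have h3 : t₀ ^ (-p) ≤ r ^ d :=
        le_trans (by linarith) (le_self_pow₀ hr1 hd.ne')
      calc (1 : ℝ) = t₀ ^ p * t₀ ^ (-p) := by rw [← Real.rpow_add ht₀]; simp
        _ ≤ _ := by gcongr
    nlinarith [Real.rpow_nonneg ht0.le p]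
  have hfin : r ^ d * r ^ ((d : ℝ) - α) * r ^ d = (r ^ (α - 3 * d))⁻¹ := by
    rw [← Real.rpow_natCast, ← Real.rpow_add hr0, ← Real.rpow_add hr0, ← Real.rpow_neg hr0.le]
    congr 1
    ring
  calc 2 * (M * ε * ‖A‖)
      = 2 * C₁ * C₂ * ‖A‖ * ((2 * (1 + r)) ^ d * (M * l ^ ((d : ℝ) - α))) := by rw [hε]; ring
    _ ≤ 2 * C₁ * C₂ * ‖A‖ * ((4 ^ d * r ^ d) *
        ((2 ^ p * (2 * (t ^ p * r ^ d))) * r ^ ((d : ℝ) - α))) := by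
        rw [hlpow]
        gcongr
        exact hMp.trans (mul_le_mul_of_nonneg_left htr (by positivity))
    _ = 2 * C₁ * C₂ * 4 ^ d * 2 ^ p * 2 * ‖A‖ *
        (t ^ p * (r ^ d * r ^ ((d : ℝ) - α) * r ^ d)) := by ring
    _ = _ := by rw [hfin, ← div_eq_mul_inv]

end Slices

/-! ### Heavy-tailed spreading on the chain -/

section Chain

lemma siteDist_eq_abs (i j : Fin 1 → ℤ) : siteDist i j = |(i 0 : ℝ) - j 0| := by
  simp [siteDist, Real.sqrt_sq_eq_abs]

/-- The total decay across the boundary layer of width `x` of an interval. -/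
lemma exists_sum_interval_decay_le {α : ℝ} (hα : 2 < α) :
    ∃ C : ℝ, 0 < C ∧ ∀ (Λ : Finset (Fin 1 → ℤ)) (X : Λ) (p x : ℝ), 0 < x →
      ∑ j ∈ (ball X (p + x))ᶜ, ∑ k ∈ ball X p, decay α j.1 k.1 ≤ C * x ^ (2 - α) := by
  obtain ⟨C₁, hC₁, h₁⟩ := exists_sum_decay_le (d := 1) one_pos (α := α) (by norm_num; linarith)
  obtain ⟨C₂, hC₂, h₂⟩ := exists_sum_decay_le (d := 1) one_pos (α := α - 1)
    (by norm_num; linarith)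
  norm_num at h₁ h₂
  refine ⟨C₁ * (2 * C₂), by positivity, fun Λ X p x hx => ?_⟩
  rcases lt_or_ge p 0 with hp | hp
  · have : ball X p = ∅ := Finset.eq_empty_of_forall_notMem fun k hk =>
      absurd (mem_ball.1 hk) (not_le.2 (hp.trans_le (siteDist_nonneg _ _)))
    rw [this]
    simp only [Finset.sum_empty, Finset.sum_const_zero]
    positivity
  -- Summing over the interval turns the decay into that of exponent `α - 1` from an endpoint `X ±
  -- ⌈p⌉`; summing over the outside then costs one more power. Rounding up keeps the endpoints on
  -- the lattice and loses less than the 1 in `1 + dist`.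
  set c : Fin 1 → ℤ := fun _ => ⌈p⌉ with hc
  have hcp : (0 : ℝ) ≤ ⌈p⌉ := by exact_mod_cast Int.ceil_nonneg hp
  have hout : ∀ j ∈ (ball X (p + x))ᶜ, p + x < siteDist j.1 X.1 ∧
      (⌈p⌉ : ℝ) ≤ siteDist j.1 X.1 := by
    intro j hj
    have h1 := notMem_ball.1 (Finset.mem_compl.1 hj)
    refine ⟨h1, ?_⟩
    rw [siteDist_eq_abs] at h1 ⊢
    have h2 : ⌈p⌉ ≤ |j.1 0 - X.1 0| := Int.ceil_le.2 (by push_cast; linarith)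
    exact_mod_cast h2
  have hrow : ∀ j ∈ (ball X (p + x))ᶜ, ∑ k ∈ ball X p, decay α j.1 k.1 ≤
      C₁ * (decay (α - 1) j.1 (X.1 + c) + decay (α - 1) j.1 (X.1 - c)) := by
    intro j hj
    obtain ⟨h1, h2⟩ := hout j hj
    have h3 : ∑ k ∈ ball X p, decay α j.1 k.1 ≤ C₁ * (1 + siteDist j.1 X.1 - p) ^ (1 - α) := by
      simp only [decay_comm α j.1]
      rw [sum_coe_eq_sum_map _ fun k => decay α k j.1]
      refine h₁ _ _ _ (by linarith) fun a b => ?_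
      obtain ⟨k, hk, rfl⟩ := Finset.mem_map.1 b
      have h4 := mem_ball.1 hk
      have h5 := siteDist_triangle j.1 k.1 X.1
      rw [siteDist_comm j.1 k.1] at h5
      simp only [Function.Embedding.subtype_apply]
      linarith
    refine h3.trans (mul_le_mul_of_nonneg_left ?_ hC₁.le)
    have h6 : ∀ y : Fin 1 → ℤ, siteDist j.1 y = siteDist j.1 X.1 - ⌈p⌉ →
        (1 + siteDist j.1 X.1 - p) ^ (1 - α) ≤ decay (α - 1) j.1 y := by
      intro y hy
      rw [decay, hy, neg_sub]
      refine Real.rpow_le_rpow_of_nonpos (by linarith) ?_ (by linarith)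
      linarith [Int.le_ceil p]
    rcases le_total ((X.1 0 : ℤ) : ℝ) (j.1 0) with h7 | h7
    · have h8 : siteDist j.1 (X.1 + c) = siteDist j.1 X.1 - ⌈p⌉ := by
        have hD : siteDist j.1 X.1 = j.1 0 - X.1 0 := by
          rw [siteDist_eq_abs, abs_of_nonneg (by linarith)]
        have : ((X.1 + c) 0 : ℝ) = X.1 0 + ⌈p⌉ := by simp [hc]
        rw [hD] at h2 ⊢
        rw [siteDist_eq_abs, this, abs_of_nonneg (by linarith)]
        ring
      linarith [h6 _ h8, decay_pos (α - 1) j.1 (X.1 - c)]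
    · have h8 : siteDist j.1 (X.1 - c) = siteDist j.1 X.1 - ⌈p⌉ := by
        have hD : siteDist j.1 X.1 = -(j.1 0 - X.1 0) := by
          rw [siteDist_eq_abs, abs_of_nonpos (by linarith)]
        have : ((X.1 - c) 0 : ℝ) = X.1 0 - ⌈p⌉ := by simp [hc]
        rw [hD] at h2 ⊢
        rw [siteDist_eq_abs, this, abs_of_nonpos (by linarith)]
        ring
      linarith [h6 _ h8, decay_pos (α - 1) j.1 (X.1 + c)]
  refine (Finset.sum_le_sum hrow).trans ?_
  rw [← Finset.mul_sum, Finset.sum_add_distrib, mul_assoc C₁]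
  refine mul_le_mul_of_nonneg_left ?_ hC₁.le
  have hcol : ∀ y : Fin 1 → ℤ, siteDist y X.1 = ⌈p⌉ →
      ∑ j ∈ (ball X (p + x))ᶜ, decay (α - 1) j.1 y ≤ C₂ * x ^ (2 - α) := by
    intro y hy
    rw [sum_coe_eq_sum_map _ fun j => decay (α - 1) j y, show 2 - α = 1 - (α - 1) by ring]
    refine h₂ _ _ x hx fun k hk => ?_
    obtain ⟨j, hj, rfl⟩ := Finset.mem_map.1 hk
    have h4 := (hout j hj).1
    have h5 := siteDist_triangle j.1 y X.1
    have h6 := Int.ceil_lt_add_one p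
    simp only [Function.Embedding.subtype_apply]
    linarith
  rw [two_mul, add_mul]
  refine add_le_add (hcol _ ?_) (hcol _ ?_)
  · simp [siteDist_eq_abs, hc, abs_of_nonneg hcp]
  · simp [siteDist_eq_abs, hc, abs_of_nonneg hcp]

/-- One big jump: in each product the larger argument is at least `z / 2`, and the remaining factor
is summable as `β > 1`. -/
lemma exists_sum_rpow_mul_rpow_le {β : ℝ} (hβ : 1 < β) :
    ∃ C : ℝ, 0 < C ∧ ∀ (N : ℕ) (z : ℝ), (N : ℝ) + 1 ≤ z →
      ∑ j ∈ Finset.range N, ((j : ℝ) + 1) ^ (-β) * (z - (j + 1)) ^ (-β) ≤ C * z ^ (-β) := by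
  set ζ := 2 ^ β / (β - 1) with hζ
  have hβ' : 0 < β - 1 := sub_pos.2 hβ
  have hsum : ∀ N : ℕ, ∑ j ∈ Finset.range N, ((j : ℝ) + 1) ^ (-β) ≤ ζ := by
    intro N
    have h1 := sum_add_rpow_neg_le hβ one_pos N
    have h2 : ∀ j ∈ Finset.range N, ((j : ℝ) + 1) ^ (-β) ≤ 2 ^ β * (1 + (j : ℝ) + 1) ^ (-β) := by
      intro j _
      have h3 := Real.rpow_le_rpow_of_nonpos (x := (1 + (j : ℝ) + 1) / 2) (y := (j : ℝ) + 1)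
        (by positivity) (by linarith [Nat.cast_nonneg (α := ℝ) j]) (show -β ≤ 0 by linarith)
      rwa [Real.div_rpow (by positivity) two_pos.le, Real.rpow_neg two_pos.le, div_inv_eq_mul,
        mul_comm] at h3
    refine (Finset.sum_le_sum h2).trans ?_
    rw [← Finset.mul_sum, hζ, div_eq_mul_one_div]
    refine mul_le_mul_of_nonneg_left ?_ (by positivity)
    rwa [Real.one_rpow] at h1
  refine ⟨2 ^ β * (ζ + ζ), by positivity, fun N z hz => ?_⟩
  have hN : (0 : ℝ) ≤ N := Nat.cast_nonneg N
  have hz0 : 0 < z := by linarith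
  have key : ∀ x y : ℝ, 0 < x → 0 < y → x ≤ y →
      x ^ (-β) * y ^ (-β) ≤ 2 ^ β * (x + y) ^ (-β) * x ^ (-β) := by
    intro x y hx hy hxy
    rw [mul_comm]
    refine mul_le_mul_of_nonneg_right ?_ (by positivity)
    have h3 := Real.rpow_le_rpow_of_nonpos (x := (x + y) / 2) (y := y)
      (by positivity) (by linarith) (show -β ≤ 0 by linarith)
    rwa [Real.div_rpow (by positivity) two_pos.le, Real.rpow_neg two_pos.le, div_inv_eq_mul,
      mul_comm] at h3
  have hterm : ∀ j ∈ Finset.range N, ((j : ℝ) + 1) ^ (-β) * (z - (j + 1)) ^ (-β) ≤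
      2 ^ β * z ^ (-β) * (((j : ℝ) + 1) ^ (-β) + (((N - 1 - j : ℕ) : ℝ) + 1) ^ (-β)) := by
    intro j hj
    have hjN := Finset.mem_range.1 hj
    have hjN' : (j : ℝ) + 1 ≤ N := by exact_mod_cast hjN
    have hj0 : (0 : ℝ) ≤ j := Nat.cast_nonneg j
    have e1 : ((N - 1 - j : ℕ) : ℝ) + 1 = N - j := by
      rw [Nat.sub_sub, Nat.cast_sub (by omega)]; push_cast; ring
    have h1 : (z - (j + 1)) ^ (-β) ≤ (((N - 1 - j : ℕ) : ℝ) + 1) ^ (-β) :=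
      Real.rpow_le_rpow_of_nonpos (by positivity) (by rw [e1]; linarith) (by linarith)
    have p1 : 0 ≤ ((j : ℝ) + 1) ^ (-β) := by positivity
    have p2 : 0 ≤ (z - ((j : ℝ) + 1)) ^ (-β) := Real.rpow_nonneg (by linarith) _
    have p3 : 0 ≤ 2 ^ β * z ^ (-β) := by positivity
    have h2 : ((j : ℝ) + 1) ^ (-β) * (z - (j + 1)) ^ (-β) ≤
        2 ^ β * z ^ (-β) * (((j : ℝ) + 1) ^ (-β) + (z - (j + 1)) ^ (-β)) := by
      rw [mul_add]
      rcases le_total ((j : ℝ) + 1) (z - (j + 1)) with h | h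
      · have := key _ _ (by positivity) (by linarith) h
        rw [add_sub_cancel] at this
        linarith [mul_nonneg p3 p2]
      · have := key _ _ (by linarith) (by positivity) h
        rw [sub_add_cancel] at this
        linarith [mul_nonneg p3 p1]
    refine h2.trans (mul_le_mul_of_nonneg_left ?_ p3)
    linarith
  refine (Finset.sum_le_sum hterm).trans ?_
  rw [← Finset.mul_sum, Finset.sum_add_distrib,
    Finset.sum_range_reflect (fun j : ℕ => ((j : ℝ) + 1) ^ (-β)) N]
  calc _ ≤ 2 ^ β * z ^ (-β) * (ζ + ζ) := by
        gcongr
        · exact hsum N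
        · exact hsum N
    _ = _ := by ring

variable {d : ℕ} {Λ : Finset (Fin d → ℤ)} {q : Λ → ℕ}

/-- During the time `T`, the support of every operator spreads from any ball around `X` to the ball
with radius increased by `x ≥ x₀`, up to the relative error `f x`. -/
def SpreadBound (ℒ : Liouvillian Λ q) (X : Λ) (T x₀ : ℝ) (f : ℝ → ℝ) : Prop :=
  ∀ (S : Finset Λ) (p : ℝ) (O : Op Λ q), (∀ i, i ∉ ball X p → O ∈ trivialAt i) →
    ∀ x, x₀ ≤ x → ∃ Q : Op Λ q, (∀ i, i ∉ ball X (p + x) → Q ∈ trivialAt i) ∧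
      ‖semigroup (ℒ.adjointOn S) T O - Q‖ ≤ f x * ‖O‖

/-- A heavy-tailed bound on the spread for the time `T` yields one for the time `2T`: the operator at
time `T` is decomposed into shells of width `b`, and at most one of the two steps is long. -/
lemma SpreadBound.double {ℒ : Liouvillian Λ q} {X : Λ} {T a b ε β C : ℝ} (hT : 0 ≤ T)
    (hb : 0 < b) (hε : 0 ≤ ε) (hβ : 1 < β) (hC : 0 ≤ C)
    (hCsum : ∀ (N : ℕ) (z : ℝ), (N : ℝ) + 1 ≤ z →
      ∑ j ∈ Finset.range N, ((j : ℝ) + 1) ^ (-β) * (z - (j + 1)) ^ (-β) ≤ C * z ^ (-β))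
    (h : SpreadBound ℒ X T (a + b) fun x => ε * ((x - a) / b) ^ (-β)) :
    SpreadBound ℒ X (2 * T) (2 * a + 3 * b) fun x =>
      ε * (2 + ε + 2 * ε * C) * ((x - (2 * a + 2 * b)) / b) ^ (-β) := by
  intro S p O hO x hx
  set z := (x - 2 * a) / b with hz
  have hz3 : 3 ≤ z := by
    rw [hz, le_div_iff₀ hb]; linarith
  have hzx : x = 2 * a + b * z := by
    rw [hz, mul_div_cancel₀ _ hb.ne']; ring
  -- The lower bound leaves every shell `j < N` enough room for the second step; the upper bound
  -- makes the remainder beyond shell `N` as small as `(z - 2)^{-β}`.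
  obtain ⟨N, hN1, hN2⟩ : ∃ N : ℕ, (N : ℝ) + 2 ≤ z ∧ z < N + 3 := by
    have h3 : 3 ≤ ⌊z⌋₊ := Nat.le_floor (by exact_mod_cast hz3)
    refine ⟨⌊z⌋₊ - 2, ?_, ?_⟩
    · rw [Nat.cast_sub (by omega)]
      push_cast
      linarith [Nat.floor_le (show 0 ≤ z by linarith)]
    · rw [Nat.cast_sub (by omega)]
      push_cast
      linarith [Nat.lt_floor_add_one z]
  set P := semigroup (ℒ.adjointOn S) T O with hP
  have hQ : ∀ j : ℕ, ∃ Q : Op Λ q, (∀ i, i ∉ ball X (p + (a + b * (j + 1))) → Q ∈ trivialAt i) ∧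
      ‖P - Q‖ ≤ ε * ((j : ℝ) + 1) ^ (-β) * ‖O‖ := by
    intro j
    obtain ⟨Q, hQ1, hQ2⟩ := h S p O hO (a + b * (j + 1)) (by nlinarith [Nat.cast_nonneg (α := ℝ) j])
    refine ⟨Q, hQ1, hQ2.trans (le_of_eq ?_)⟩
    simp only [add_sub_cancel_left, mul_div_cancel_left₀ _ hb.ne']
  choose Q hQ1 hQ2 using hQ
  -- Shell `j` of the operator at time `T`: its norm is of order `ε (j+1)^{-β}`, and it spends the
  -- rest of the allowed displacement in the second step. Only these shells produce the convolution,
  -- at order `ε²`.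
  set D : ℕ → Op Λ q := fun j => Q (j + 1) - Q j with hD
  have hD1 : ∀ (j : ℕ) (i), i ∉ ball X (p + (a + b * (j + 2))) → D j ∈ trivialAt i := by
    intro j i hi
    refine Submodule.sub_mem _ (hQ1 (j + 1) i ?_) (hQ1 j i fun hi' => hi (ball_subset_ball ?_ hi'))
    · push_cast
      rwa [show (j : ℝ) + 1 + 1 = j + 2 by ring]
    · nlinarith
  have hD2 : ∀ j, ‖D j‖ ≤ 2 * ε * ((j : ℝ) + 1) ^ (-β) * ‖O‖ := by
    intro j
    have e : D j = (P - Q j) - (P - Q (j + 1)) := by simp only [hD]; abel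
    rw [e]
    refine (norm_sub_le _ _).trans ?_
    have h1 := hQ2 j
    have h2 := hQ2 (j + 1)
    have h3 : (((j + 1 : ℕ) : ℝ) + 1) ^ (-β) ≤ ((j : ℝ) + 1) ^ (-β) :=
      Real.rpow_le_rpow_of_nonpos (by positivity) (by push_cast; linarith) (by linarith)
    have h4 : ε * (((j + 1 : ℕ) : ℝ) + 1) ^ (-β) * ‖O‖ ≤ ε * ((j : ℝ) + 1) ^ (-β) * ‖O‖ := by
      gcongr
    linarith
  have hQ0 : ‖Q 0‖ ≤ (1 + ε) * ‖O‖ := by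
    have e : Q 0 = P - (P - Q 0) := by abel
    rw [e]
    refine (norm_sub_le _ _).trans ?_
    have h1 := hQ2 0
    have h2 := (ℒ.isDissipative_adjointOn S).norm_semigroup_apply_le hT O
    simp only [Nat.cast_zero, zero_add, Real.one_rpow, mul_one] at h1
    linarith
  obtain ⟨R₀, hR1, hR2⟩ := h S _ (Q 0) (hQ1 0) (a + b * (z - 1)) (by nlinarith)
  have hR : ∀ j : ℕ, ∃ R : Op Λ q, j ∈ Finset.range N →
      (∀ i, i ∉ ball X (p + x) → R ∈ trivialAt i) ∧
      ‖semigroup (ℒ.adjointOn S) T (D j) - R‖ ≤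
        2 * ε ^ 2 * (((j : ℝ) + 1) ^ (-β) * (z - 1 - (j + 1)) ^ (-β)) * ‖O‖ := by
    intro j
    by_cases hj : j ∈ Finset.range N
    · have hj' : (j : ℝ) + 1 ≤ N := by exact_mod_cast Finset.mem_range.1 hj
      obtain ⟨R, hRj1, hRj2⟩ := h S _ (D j) (hD1 j) (a + b * (z - 1 - (j + 1))) (by nlinarith)
      refine ⟨R, fun _ => ⟨fun i hi => hRj1 i ?_, hRj2.trans ?_⟩⟩
      · convert hi using 3
        rw [hzx]; ring
      · simp only [add_sub_cancel_left, mul_div_cancel_left₀ _ hb.ne']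
        have p1 : 0 ≤ (z - 1 - ((j : ℝ) + 1)) ^ (-β) := Real.rpow_nonneg (by linarith) _
        calc _ ≤ ε * (z - 1 - ((j : ℝ) + 1)) ^ (-β) * (2 * ε * ((j : ℝ) + 1) ^ (-β) * ‖O‖) :=
              mul_le_mul_of_nonneg_left (hD2 j) (by positivity)
          _ = _ := by ring
    · exact ⟨0, fun hj' => absurd hj' hj⟩
  choose R hR using hR
  refine ⟨R₀ + ∑ j ∈ Finset.range N, R j, fun i hi => Submodule.add_mem _ (hR1 i ?_)
    (Submodule.sum_mem _ fun j hj => (hR j hj).1 i hi), ?_⟩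
  · convert hi using 3
    rw [hzx]
    push_cast
    ring
  have hQN : Q N = Q 0 + ∑ j ∈ Finset.range N, D j := by
    rw [Finset.sum_range_sub]; abel
  have e : semigroup (ℒ.adjointOn S) (2 * T) O - (R₀ + ∑ j ∈ Finset.range N, R j) =
      semigroup (ℒ.adjointOn S) T (P - Q N) + (semigroup (ℒ.adjointOn S) T (Q 0) - R₀) +
        ∑ j ∈ Finset.range N, (semigroup (ℒ.adjointOn S) T (D j) - R j) := by
    rw [two_mul, semigroup_add_apply, ← hP, Finset.sum_sub_distrib, ← map_sum, map_sub, hQN,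
      map_add]
    abel
  have hz2 : 0 < z - 2 := by linarith
  have p1 : 0 ≤ (z - 2) ^ (-β) := by positivity
  have h12 : (z - 1) ^ (-β) ≤ (z - 2) ^ (-β) :=
    Real.rpow_le_rpow_of_nonpos hz2 (by linarith) (by linarith)
  have t1 : ‖semigroup (ℒ.adjointOn S) T (P - Q N)‖ ≤ ε * (z - 2) ^ (-β) * ‖O‖ := by
    refine ((ℒ.isDissipative_adjointOn S).norm_semigroup_apply_le hT _).trans ((hQ2 N).trans ?_)
    have : ((N : ℝ) + 1) ^ (-β) ≤ (z - 2) ^ (-β) :=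
      Real.rpow_le_rpow_of_nonpos hz2 (by linarith) (by linarith)
    gcongr
  have t2 : ‖semigroup (ℒ.adjointOn S) T (Q 0) - R₀‖ ≤ ε * (1 + ε) * (z - 2) ^ (-β) * ‖O‖ := by
    refine hR2.trans ?_
    simp only [add_sub_cancel_left, mul_div_cancel_left₀ _ hb.ne']
    calc _ ≤ ε * (z - 2) ^ (-β) * ((1 + ε) * ‖O‖) := by gcongr
      _ = _ := by ring
  have t3 : ‖∑ j ∈ Finset.range N, (semigroup (ℒ.adjointOn S) T (D j) - R j)‖ ≤
      2 * ε ^ 2 * (C * (z - 2) ^ (-β)) * ‖O‖ := by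
    refine (norm_sum_le_of_le _ fun j hj => (hR j hj).2).trans ?_
    rw [← Finset.sum_mul, ← Finset.mul_sum]
    have := (hCsum N (z - 1) (by linarith)).trans (mul_le_mul_of_nonneg_left h12 hC)
    gcongr
  have efin : (x - (2 * a + 2 * b)) / b = z - 2 := by
    rw [hzx]; field_simp; ring
  rw [e]
  simp only [efin]
  refine (norm_add₃_le).trans ?_
  calc _ ≤ _ := add_le_add (add_le_add t1 t2) t3
    _ = _ := by ring

end Chain

/-! ### Dyadic times and the linear light cone -/

section LinearLightCone

/-- Heavy-tailed spread bounds with a linearly growing offset, at all dyadic times. -/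
lemma exists_spreadBound {α : ℝ} (hα : 3 < α) :
    ∃ ε B c L ρ : ℝ, 0 < ε ∧ 0 < B ∧ 0 < c ∧ 0 < ρ ∧ ρ ≤ 2 ∧ 0 < L ∧ L ≤ 4 ∧ ρ ^ (α - 2) = L ∧
      ∀ (Λ : Finset (Fin 1 → ℤ)) (q : Λ → ℕ) (ℒ : Liouvillian Λ q), ℒ.IsLongRange α →
      ∀ (X : Λ) (k : ℕ) (τ : ℝ), 0 ≤ τ → τ ≤ 1 →
        SpreadBound ℒ X (2 ^ k * τ) (c * (2 ^ k - ρ ^ k) + B * ρ ^ k)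
          fun x => ε * ((x - c * (2 ^ k - ρ ^ k)) / (B * ρ ^ k)) ^ (-(α - 2)) := by
  obtain ⟨C₁, hC₁, h₁⟩ := exists_norm_semigroup_sub_le_of_le_one (d := 1) one_pos
    (by linarith : 0 < α) (by norm_num; linarith)
  obtain ⟨C₂, hC₂, h₂⟩ := exists_sum_interval_decay_le (by linarith : 2 < α)
  set β := α - 2 with hβ
  have hβ1 : 1 < β := by linarith
  have hβ0 : 0 < β := by linarith
  obtain ⟨C, hC, hCsum⟩ := exists_sum_rpow_mul_rpow_le hβ1
  -- `γ > 1` leaves room above the factor 2 of each doubling, `γ < β` makes the widths grow more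
  -- slowly than time, and `γ ≤ 2` limits the growth of the tail to the square of the time.
  set γ := min 2 ((1 + β) / 2) with hγ
  have hγ2 : γ ≤ 2 := min_le_left _ _
  have hγ1 : 1 < γ := lt_min one_lt_two (by linarith)
  have hγβ : γ < β := (min_le_right _ _).trans_lt (by linarith)
  set ρ : ℝ := 2 ^ (γ / β) with hρ
  set L : ℝ := 2 ^ γ with hL
  have hρ0 : 0 < ρ := by positivity
  have hρ2 : ρ < 2 := by
    have := Real.rpow_lt_rpow_of_exponent_lt one_lt_two ((div_lt_one hβ0).2 hγβ)
    rwa [Real.rpow_one] at this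
  have hρL : ρ ^ β = L := by
    rw [hρ, ← Real.rpow_mul two_pos.le, div_mul_cancel₀ _ hβ0.ne']
  have hL2 : 2 < L := by
    have := Real.rpow_lt_rpow_of_exponent_lt one_lt_two hγ1
    rwa [Real.rpow_one] at this
  have hL4 : L ≤ 4 := by
    have := Real.rpow_le_rpow_of_exponent_le one_le_two hγ2
    norm_num at this
    exact this
  -- Chosen so that the factor lost in `SpreadBound.double` is exactly `L = ρ^β`; enlarging the
  -- width by `ρ` then restores the same `ε`.
  set ε := (L - 2) / (1 + 2 * C) with hε
  have hε0 : 0 < ε := div_pos (by linarith) (by linarith)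
  have hεL : 2 + ε + 2 * ε * C = L := by
    rw [hε]; field_simp; ring
  -- The initial width fits the bound for times up to 1.
  set B := (C₁ * C₂ / ε) ^ (1 / β) with hB
  have hB0 : 0 < B := by positivity
  have hBε : ε * B ^ β = C₁ * C₂ := by
    rw [hB, ← Real.rpow_mul (by positivity), one_div_mul_cancel hβ0.ne', Real.rpow_one]
    field_simp
  -- The offsets obey `a' = 2a + 2Bρ^k`, solved by `a = c (2^k - ρ^k)`.
  set c := 2 * B / (2 - ρ) with hc
  have hc0 : 0 < c := div_pos (by linarith) (by linarith)
  refine ⟨ε, B, c, L, ρ, hε0, hB0, hc0, hρ0, hρ2.le, by linarith, hL4, hρL, ?_⟩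
  intro Λ q ℒ h X k τ hτ0 hτ1
  induction k with
  | zero =>
    intro S p O hO x hx
    simp only [pow_zero, sub_self, mul_zero, zero_add, mul_one, one_mul, sub_zero] at hx ⊢
    have hx0 : 0 < x := hB0.trans_le hx
    refine ⟨semigroup (ℒ.adjointOn (S ∩ ball X (p + x))) τ O, fun i hi => ?_, ?_⟩
    · exact ℒ.semigroup_adjointOn_mem_trivialAt (fun hi' => hi (Finset.mem_inter.1 hi').2) τ
        (hO i fun hi' => hi (ball_subset_ball (by linarith) hi'))
    · refine (h₁ Λ q ℒ h S _ _ (ball_subset_ball (by linarith)) O hO τ hτ0 hτ1).trans ?_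
      have h3 := h₂ Λ X p x hx0
      calc _ ≤ C₁ * ‖O‖ * (C₂ * x ^ (2 - α)) := by gcongr
        _ = C₁ * C₂ * x ^ (2 - α) * ‖O‖ := by ring
        _ = _ := by
          rw [← hBε, Real.div_rpow hx0.le hB0.le, Real.rpow_neg hB0.le, div_inv_eq_mul,
            show 2 - α = -β by rw [hβ]; ring]
          ring
  | succ k ih =>
    have hb : 0 < B * ρ ^ k := by positivity
    have hd := SpreadBound.double (by positivity) hb hε0.le hβ1 hC.le hCsum ih
    have ea : 2 * (c * (2 ^ k - ρ ^ k)) + 2 * (B * ρ ^ k) = c * (2 ^ (k + 1) - ρ ^ (k + 1)) := by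
      have : 2 * B = c * (2 - ρ) := by
        rw [hc, div_mul_cancel₀ _ (by linarith)]
      linear_combination ρ ^ k * this
    have e2 : (2 : ℝ) ^ (k + 1) * τ = 2 * (2 ^ k * τ) := by ring
    rw [ea, hεL] at hd
    rw [e2]
    intro S p O hO x hx
    have hρ1 : 1 ≤ ρ := Real.one_le_rpow one_le_two (by positivity)
    have hb' : B * ρ ^ k ≤ B * ρ ^ (k + 1) :=
      mul_le_mul_of_nonneg_left (pow_le_pow_right₀ hρ1 k.le_succ) hB0.le
    obtain ⟨Q, hQ1, hQ2⟩ := hd S p O hO x (by linarith)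
    refine ⟨Q, hQ1, hQ2.trans (le_of_eq ?_)⟩
    have hy : 0 < x - c * (2 ^ (k + 1) - ρ ^ (k + 1)) := by linarith
    have e3 : (x - c * (2 ^ (k + 1) - ρ ^ (k + 1))) / (B * ρ ^ (k + 1)) =
        (x - c * (2 ^ (k + 1) - ρ ^ (k + 1))) / (B * ρ ^ k) / ρ := by
      rw [div_div, pow_succ]; ring
    simp only [e3]
    rw [Real.div_rpow (by positivity) hρ0.le, Real.rpow_neg hρ0.le, hρL, div_inv_eq_mul]
    ring

/-- Errors of single slices add because `G` contracts. They are measured along the `H`-evolution,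
which in the application is the truncated one. -/
lemma norm_semigroup_nat_mul_sub_le {E : Type*} [NormedAddCommGroup E] [NormedSpace ℂ E]
    [CompleteSpace E] {G H : E →L[ℂ] E} (hG : IsDissipative ⇑G) {τ η : ℝ} (hτ : 0 ≤ τ) {x : E}
    {M : ℕ} (h : ∀ m : ℕ, m < M →
      ‖semigroup G τ (semigroup H (m * τ) x) - semigroup H τ (semigroup H (m * τ) x)‖ ≤ η)
    (m : ℕ) (hm : m ≤ M) : ‖semigroup G (m * τ) x - semigroup H (m * τ) x‖ ≤ m * η := by
  induction m with
  | zero => simp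
  | succ m ih =>
    have e : ((m + 1 : ℕ) : ℝ) * τ = τ + m * τ := by push_cast; ring
    rw [e, semigroup_add_apply, semigroup_add_apply]
    have e2 : semigroup G τ (semigroup G (m * τ) x) - semigroup H τ (semigroup H (m * τ) x) =
        semigroup G τ (semigroup G (m * τ) x - semigroup H (m * τ) x) +
        (semigroup G τ (semigroup H (m * τ) x) - semigroup H τ (semigroup H (m * τ) x)) := by
      rw [map_sub]; abel
    rw [e2]
    refine (norm_add_le _ _).trans ?_
    have h1 := (hG.norm_semigroup_apply_le hτ _).trans (ih (by omega))
    have h2 := h m (by omega)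
    push_cast
    linarith

lemma one_add_mul_sq_le {t : ℝ} (ht : 0 ≤ t) : (1 + t) * (1 + t) ^ 2 ≤ 4 * (t ^ 3 + 1) := by
  nlinarith [mul_nonneg (show 0 ≤ 1 + t by linarith) (sq_nonneg (t - 1))]

-- At each slice the truncated evolution is close to an operator supported in the ball of radius `r
-- / 2`, and for that operator one more slice barely feels the exterior of the ball of radius `r`.
-- Each slice errs by order `(1+t)² r^{-(α-2)}`, there are at most `1 + t` slices, and `v t ≤ r`
-- trades one power of `t` for one of `r`.
set_option maxHeartbeats 1600000 in
theorem exists_truncationError_le_of_linear_lightCone {α : ℝ} (hα : 3 < α) :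
    ∃ K v : ℝ, 0 < K ∧ 0 < v ∧ ∀ t₀ : ℝ, 0 < t₀ → ∃ r₀ : ℝ, 0 < r₀ ∧
      ∀ (Λ : Finset (Fin 1 → ℤ)) (q : Λ → ℕ) (ℒ : Liouvillian Λ q), ℒ.IsLongRange α →
      ∀ (X : Λ) (A : Op Λ q), SupportedOn {X} A → ∀ r t : ℝ, r₀ ≤ r → t₀ ≤ t → v * t ≤ r →
        truncationError ℒ X r t A ≤ K * ‖A‖ * (t ^ 2 / r ^ (α - 3)) := by
  obtain ⟨C₁, hC₁, h₁⟩ := exists_norm_semigroup_sub_le_of_le_one (d := 1) one_pos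
    (by linarith : 0 < α) (by norm_num; linarith)
  obtain ⟨C₂, hC₂, h₂⟩ := exists_sum_interval_decay_le (by linarith : 2 < α)
  obtain ⟨ε, B, c, L, ρ, hε, hB, hc, hρ, hρ2, hL, hL4, hρL, hspread⟩ := exists_spreadBound hα
  set β := α - 2 with hβ
  have hβ0 : 0 < β := by linarith
  set v := 16 * (c + B) with hv
  have hv0 : 0 < v := by positivity
  set D := C₁ * C₂ * 2 ^ β * (1 + ε) + 8 * (ε * (4 * B) ^ β) with hD
  have hD0 : 0 < D := by positivity
  -- `r₀ ≥ v` handles times below 1 in the cone condition; `r₀ ≥ t₀^{-2}` gives `1 ≤ t² r`, which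
  -- absorbs the constant term of the cubic.
  refine ⟨D * 4 * (1 / v + 1), v, by positivity, hv0, fun t₀ ht₀ => ⟨v + (t₀ ^ 2)⁻¹,
    by positivity, ?_⟩⟩
  intro Λ q ℒ h X A hA r t hr ht hvt
  have ht0 : 0 < t := ht₀.trans_le ht
  have hrv : v ≤ r := le_trans (by linarith [show 0 < (t₀ ^ 2)⁻¹ by positivity]) hr
  have hr0 : 0 < r := hv0.trans_le hrv
  have hrt : 1 ≤ t ^ 2 * r := by
    have h3 : (t₀ ^ 2)⁻¹ ≤ r := by linarith
    have h4 : t₀ ^ 2 ≤ t ^ 2 := by gcongr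
    calc (1 : ℝ) = t₀ ^ 2 * (t₀ ^ 2)⁻¹ := by field_simp
      _ ≤ _ := by gcongr
  obtain ⟨k, hk1, hk2⟩ : ∃ k : ℕ, t ≤ 2 ^ k ∧ (2 : ℝ) ^ k ≤ 2 * (1 + t) := by
    obtain ⟨n, hn1, hn2⟩ := exists_nat_pow_near (le_max_right t 1) one_lt_two
    refine ⟨n + 1, (le_max_left t 1).trans hn2.le, ?_⟩
    have : max t 1 ≤ 1 + t := max_le (by linarith) (by linarith)
    rw [pow_succ]
    linarith
  set M := ⌈t⌉₊ with hM
  have hM0 : 0 < M := Nat.ceil_pos.2 ht0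
  have hM0' : (0 : ℝ) < M := Nat.cast_pos.2 hM0
  have htM : t ≤ M := Nat.le_ceil t
  have hMt : (M : ℝ) ≤ 1 + t := by linarith [Nat.ceil_lt_add_one ht0.le]
  have h2k : (0 : ℝ) < 2 ^ k := by positivity
  have hρk : ρ ^ k ≤ 2 ^ k := pow_le_pow_left₀ hρ.le hρ2 k
  have hρk0 : 0 < ρ ^ k := by positivity
  set a := c * (2 ^ k - ρ ^ k) with ha
  set b := B * ρ ^ k with hb
  have hb0 : 0 < b := by positivity
  have hrk : 4 * (c + B) * 2 ^ k ≤ r := by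
    have : 4 * (c + B) * 2 ^ k ≤ 4 * (c + B) * (2 * (1 + t)) := by gcongr
    have e : 4 * (c + B) * (2 * (1 + t)) = (v + v * t) / 2 := by rw [hv]; ring
    linarith
  have hac : a ≤ c * 2 ^ k := mul_le_mul_of_nonneg_left (by linarith) hc.le
  have hbc : b ≤ B * 2 ^ k := mul_le_mul_of_nonneg_left hρk hB.le
  have hpc : 0 < c * 2 ^ k := by positivity
  have hpB : 0 < B * 2 ^ k := by positivity
  have ha4 : r / 4 ≤ r / 2 - a := by linarith
  have hab : a + b ≤ r / 2 := by linarith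
  set δ := ε * ((r / 2 - a) / b) ^ (-β) with hδ
  have hδε : δ ≤ ε := by
    refine mul_le_of_le_one_right hε.le (Real.rpow_le_one_of_one_le_of_nonpos ?_ (by linarith))
    rw [one_le_div hb0]
    linarith
  have hδ0 : 0 ≤ δ := mul_nonneg hε.le (Real.rpow_nonneg (div_nonneg (by linarith) hb0.le) _)
  have hδr : δ ≤ ε * (4 * B) ^ β * (4 * (1 + t) ^ 2) * r ^ (-β) := by
    have h3 : ((r / 2 - a) / b) ^ (-β) ≤ (r / 4 / b) ^ (-β) :=
      Real.rpow_le_rpow_of_nonpos (by positivity) (by gcongr) (by linarith)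
    have h4 : (r / 4 / b) ^ (-β) = (4 * B) ^ β * L ^ k * r ^ (-β) := by
      rw [show r / 4 / b = r / (4 * B * ρ ^ k) by rw [hb, div_div, mul_assoc],
        Real.div_rpow hr0.le (by positivity), Real.rpow_neg (show 0 ≤ 4 * B * ρ ^ k by positivity),
        div_inv_eq_mul, Real.mul_rpow (by positivity) hρk0.le, ← hρL, ← Real.rpow_natCast,
        ← Real.rpow_natCast, ← Real.rpow_mul hρ.le, ← Real.rpow_mul hρ.le, mul_comm (k : ℝ)]
      ring
    have h5 : L ^ k ≤ 4 * (1 + t) ^ 2 := by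
      calc L ^ k ≤ 4 ^ k := pow_le_pow_left₀ hL.le hL4 k
        _ = (2 ^ k) ^ 2 := by rw [← pow_mul, mul_comm, pow_mul]; norm_num
        _ ≤ (2 * (1 + t)) ^ 2 := pow_le_pow_left₀ h2k.le hk2 2
        _ = _ := by ring
    calc δ ≤ ε * ((4 * B) ^ β * L ^ k * r ^ (-β)) :=
          mul_le_mul_of_nonneg_left (h3.trans_eq h4) hε.le
      _ ≤ ε * ((4 * B) ^ β * (4 * (1 + t) ^ 2) * r ^ (-β)) := by gcongr
      _ = _ := by ring
  set η := D * (1 + t) ^ 2 * r ^ (-β) * ‖A‖ with hη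
  have hr2 : (r / 2) ^ (2 - α) = 2 ^ β * r ^ (-β) := by
    rw [show 2 - α = -β by rw [hβ]; ring, Real.div_rpow hr0.le two_pos.le,
      Real.rpow_neg two_pos.le, div_inv_eq_mul, mul_comm]
  have hstep : ∀ m : ℕ, m < M →
      ‖semigroup (ℒ.adjointOn Finset.univ) (t / M)
          (semigroup (ℒ.adjointOn (Finset.univ ∩ ball X r)) (m * (t / M)) A) -
        semigroup (ℒ.adjointOn (Finset.univ ∩ ball X r)) (t / M)
          (semigroup (ℒ.adjointOn (Finset.univ ∩ ball X r)) (m * (t / M)) A)‖ ≤ η := by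
    intro m hm
    have hs0 : 0 ≤ m * (t / M) := by positivity
    have hst : m * (t / M) ≤ t := by
      rw [mul_div_assoc', div_le_iff₀ hM0', mul_comm]
      exact mul_le_mul_of_nonneg_left (Nat.cast_le.2 hm.le) ht0.le
    have hτ0 : 0 ≤ t / M := by positivity
    have hτ1 : t / M ≤ 1 := (div_le_one hM0').2 htM
    -- All slice times are written as `2^k τ` with the same `k` and `τ ≤ 1`, so a single dyadic
    -- level serves every slice.
    have hsp := hspread Λ q ℒ h X k (m * (t / M) / 2 ^ k) (by positivity)
      ((div_le_one h2k).2 (hst.trans hk1))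
    rw [mul_div_cancel₀ _ h2k.ne'] at hsp
    have hA0 : ∀ i, i ∉ ball X 0 → A ∈ trivialAt i := by
      intro i hi
      refine hA.mem_trivialAt fun hi' => hi ?_
      rw [Finset.mem_singleton] at hi'
      simp [mem_ball, hi']
    set T := Finset.univ ∩ ball X r with hT
    obtain ⟨Q, hQ1, hQ2⟩ := hsp T 0 A hA0 (r / 2) hab
    set P := semigroup (ℒ.adjointOn T) (m * (t / M)) A with hP
    have hPA : ‖P‖ ≤ ‖A‖ := (ℒ.isDissipative_adjointOn T).norm_semigroup_apply_le hs0 A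
    replace hQ2 : ‖P - Q‖ ≤ δ * ‖A‖ := hQ2
    have hQA : ‖Q‖ ≤ (1 + ε) * ‖A‖ := by
      have e : Q = P - (P - Q) := by abel
      rw [e]
      refine (norm_sub_le _ _).trans ?_
      have := mul_le_mul_of_nonneg_right hδε (norm_nonneg A)
      linarith
    have hslice := h₁ Λ q ℒ h Finset.univ (ball X r) _ (ball_subset_ball (by linarith)) Q hQ1
      (t / M) hτ0 hτ1
    have hbd := h₂ Λ X (0 + r / 2) (r / 2) (by positivity)
    rw [show 0 + r / 2 + r / 2 = r by ring, hr2] at hbd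
    have e : semigroup (ℒ.adjointOn Finset.univ) (t / M) P - semigroup (ℒ.adjointOn T) (t / M) P =
        (semigroup (ℒ.adjointOn Finset.univ) (t / M) Q - semigroup (ℒ.adjointOn T) (t / M) Q) +
        (semigroup (ℒ.adjointOn Finset.univ) (t / M) (P - Q) -
          semigroup (ℒ.adjointOn T) (t / M) (P - Q)) := by
      rw [map_sub, map_sub]; abel
    rw [e]
    refine (norm_add_le _ _).trans ?_
    have t1 : ‖semigroup (ℒ.adjointOn Finset.univ) (t / M) Q -
        semigroup (ℒ.adjointOn T) (t / M) Q‖ ≤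
        C₁ * ((1 + ε) * ‖A‖) * (C₂ * (2 ^ β * r ^ (-β))) := by
      refine hslice.trans ?_
      refine mul_le_mul (mul_le_mul_of_nonneg_left hQA hC₁.le) hbd ?_ (by positivity)
      exact Finset.sum_nonneg fun _ _ => Finset.sum_nonneg fun _ _ => (decay_pos _ _ _).le
    have t2 : ‖semigroup (ℒ.adjointOn Finset.univ) (t / M) (P - Q) -
        semigroup (ℒ.adjointOn T) (t / M) (P - Q)‖ ≤ 2 * (δ * ‖A‖) := by
      rw [two_mul]
      exact (norm_sub_le _ _).trans (add_le_add
        (((ℒ.isDissipative_adjointOn _).norm_semigroup_apply_le hτ0 _).trans hQ2)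
        (((ℒ.isDissipative_adjointOn _).norm_semigroup_apply_le hτ0 _).trans hQ2))
    have t3 : 2 * (δ * ‖A‖) ≤
        2 * ((ε * (4 * B) ^ β * (4 * (1 + t) ^ 2) * r ^ (-β)) * ‖A‖) := by gcongr
    have h1t : 1 ≤ (1 + t) ^ 2 := one_le_pow₀ (by linarith)
    have t4 : C₁ * ((1 + ε) * ‖A‖) * (C₂ * (2 ^ β * r ^ (-β))) ≤
        C₁ * C₂ * 2 ^ β * (1 + ε) * (1 + t) ^ 2 * r ^ (-β) * ‖A‖ := by
      calc _ = C₁ * C₂ * 2 ^ β * (1 + ε) * 1 * r ^ (-β) * ‖A‖ := by ring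
        _ ≤ _ := by gcongr
    calc _ ≤ _ := add_le_add (t1.trans t4) (t2.trans t3)
      _ = η := by rw [hη, hD]; ring
  have htot := norm_semigroup_nat_mul_sub_le (ℒ.isDissipative_adjointOn Finset.univ)
    (by positivity) hstep M le_rfl
  rw [mul_div_cancel₀ _ hM0'.ne'] at htot
  rw [truncationError_eq]
  refine htot.trans ?_
  have hcube : (1 + t) * (1 + t) ^ 2 ≤ 4 * (1 / v + 1) * (t ^ 2 * r) := by
    have h3 := one_add_mul_sq_le ht0.le
    have h4 : t ^ 3 ≤ 1 / v * (t ^ 2 * r) := by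
      have h5 : t ≤ r / v := by rw [le_div_iff₀ hv0]; linarith
      calc t ^ 3 = t ^ 2 * t := by ring
        _ ≤ t ^ 2 * (r / v) := by gcongr
        _ = _ := by ring
    linarith
  have hrr : r * r ^ (-β) = (r ^ (α - 3))⁻¹ := by
    rw [← Real.rpow_neg hr0.le, ← Real.rpow_one_add' hr0.le]
    · congr 1
      rw [hβ]; ring
    · rw [hβ]
      intro h0
      linarith
  calc M * η ≤ (1 + t) * η := by gcongr
    _ = D * r ^ (-β) * ‖A‖ * ((1 + t) * (1 + t) ^ 2) := by rw [hη]; ring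
    _ ≤ D * r ^ (-β) * ‖A‖ * (4 * (1 / v + 1) * (t ^ 2 * r)) := by gcongr
    _ = D * 4 * (1 / v + 1) * ‖A‖ * (t ^ 2 * (r * r ^ (-β))) := by ring
    _ = _ := by rw [hrr, ← div_eq_mul_inv]

end LinearLightCone

end OpenLattice

theorem lemma1 (d : ℕ) (hd : 0 < d) (α : ℝ) (hα : 0 < α) :
    -- first line: `e^{vt} / r^{α-d}` for `α > d`
    ((d : ℝ) < α → ∃ K v : ℝ, 0 < K ∧ 0 < v ∧
      ∀ (Λ : Finset (Fin d → ℤ)) (q : Λ → ℕ) (ℒ : Liouvillian Λ q), ℒ.IsLongRange α →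
      ∀ (X : Λ) (A : Op Λ q), SupportedOn {X} A → ∀ r t : ℝ, 0 < r → 0 ≤ t →
        truncationError ℒ X r t A ≤ K * ‖A‖ * (Real.exp (v * t) / r ^ (α - d))) ∧
    -- second line: `t^{α-d+1} / r^{α-3d}` for `α > 3d`
    (3 * (d : ℝ) < α → ∃ K : ℝ, 0 < K ∧ ∀ t₀ : ℝ, 0 < t₀ → ∃ r₀ : ℝ, 0 < r₀ ∧
      ∀ (Λ : Finset (Fin d → ℤ)) (q : Λ → ℕ) (ℒ : Liouvillian Λ q), ℒ.IsLongRange α →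
      ∀ (X : Λ) (A : Op Λ q), SupportedOn {X} A → ∀ r t : ℝ, r₀ ≤ r → t₀ ≤ t →
        truncationError ℒ X r t A ≤ K * ‖A‖ * (t ^ (α - d + 1) / r ^ (α - 3 * d))) ∧
    -- third line: `t^2 / r^{α-3}` for `α > 3`, `d = 1`, outside of a linear light cone
    (d = 1 → 3 < α → ∃ K v : ℝ, 0 < K ∧ 0 < v ∧ ∀ t₀ : ℝ, 0 < t₀ → ∃ r₀ : ℝ, 0 < r₀ ∧
      ∀ (Λ : Finset (Fin d → ℤ)) (q : Λ → ℕ) (ℒ : Liouvillian Λ q), ℒ.IsLongRange α →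
      ℒ.IsTwoBody →
      ∀ (X : Λ) (A : Op Λ q), SupportedOn {X} A → ∀ r t : ℝ, r₀ ≤ r → t₀ ≤ t → v * t ≤ r →
        truncationError ℒ X r t A ≤ K * ‖A‖ * (t ^ 2 / r ^ (α - 3))) ∧
    -- `α < d`, with `r` at least proportional to `N^{1/d}`
    (α < d → ∃ c : ℝ, 0 < c ∧ ∀ κ : ℝ, 0 < κ →
      (∃ K : ℝ, 0 < K ∧
        ∀ (Λ : Finset (Fin d → ℤ)) (q : Λ → ℕ) (ℒ : Liouvillian Λ q), ℒ.IsLongRange α →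
        ∀ (X : Λ) (A : Op Λ q), SupportedOn {X} A →
        ∀ r t : ℝ, κ * (Λ.card : ℝ) ^ (1 / (d : ℝ)) ≤ r → 0 ≤ t →
          truncationError ℒ X r t A ≤
            K * ‖A‖ * (Real.exp (c * (Λ.card : ℝ) ^ (1 - α / d) * t) - 1)) ∧
      (∀ t₀ : ℝ, 0 < t₀ → ∃ K : ℝ, 0 < K ∧
        ∀ (Λ : Finset (Fin d → ℤ)) (q : Λ → ℕ) (ℒ : Liouvillian Λ q), ℒ.IsLongRange α →
        ∀ (X : Λ) (A : Op Λ q), SupportedOn {X} A →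
        ∀ r t : ℝ, κ * (Λ.card : ℝ) ^ (1 / (d : ℝ)) ≤ r → t₀ ≤ t →
          truncationError ℒ X r t A ≤
            K * ‖A‖ * ((Real.exp (c * (Λ.card : ℝ) ^ (1 - α / d) * t) - 1) /
              (c * (Λ.card : ℝ) ^ (1 - α / d))))) ∧
    -- `α = d`, with `r` at least proportional to `N^{1/d}`
    (α = d → ∃ c : ℝ, 0 < c ∧ ∀ κ : ℝ, 0 < κ → ∃ K : ℝ, 0 < K ∧
      ∀ (Λ : Finset (Fin d → ℤ)) (q : Λ → ℕ) (ℒ : Liouvillian Λ q), ℒ.IsLongRange α →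
      2 ≤ Λ.card →
      ∀ (X : Λ) (A : Op Λ q), SupportedOn {X} A →
      ∀ r t : ℝ, κ * (Λ.card : ℝ) ^ (1 / (d : ℝ)) ≤ r → 0 ≤ t →
        truncationError ℒ X r t A ≤
          K * ‖A‖ * ((Real.exp (c * Real.log Λ.card * t) - 1) / (c * Real.log Λ.card))) := by
  refine ⟨fun h => exists_truncationError_le_exp hd hα h,
    fun h => exists_truncationError_le_pow hd hα h, ?_,
    fun h => exists_truncationError_le_of_lt hd hα h, fun h => exists_truncationError_le_log hd h⟩
  rintro rfl h3
  obtain ⟨K, v, hK, hv, H⟩ := exists_truncationError_le_of_linear_lightCone h3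
  refine ⟨K, v, hK, hv, fun t₀ ht₀ => ?_⟩
  obtain ⟨r₀, hr₀, H'⟩ := H t₀ ht₀
  exact ⟨r₀, hr₀, fun Λ q ℒ h _ => H' Λ q ℒ h⟩
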